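/- Let $A=(a_{ij})$ be a real $4\times 4$ visualized idempotent matrix: $a_{ij}\le 0$, $a_{ii}=0$, $a_{4j}=0$ and $a_{ik}+a_{kj}\le a_{ij}$ for all $i,j,k\in\{1,2,3,4\}$. Let $\mathcal P(A)\subset\mathbb R^3$ be the set of all max-plus linear combinations of the columns of $A$ whose fourth coordinate is $0$, with $\{x_4=0\}$ identified with $\mathbb R^3$. Call $\mathcal P(A)$ a maximal alcoved dodecahedron if it has $20$ vertices, $30$ edges and $12$ facets (the maximal $f$-vector of an alcoved polyhedron in $\mathbb R^3$). The North Pole $N$ of $\mathcal P(A)$ is its coordinatewise maximum, and the North Cask is the union of the facets containing $N$, regarded as a polyhedral complex. Write $a_{ij;kl}=a_{ik}+a_{jl}-a_{il}-a_{jk}$, and reduce the indices $i\pm1$ modulo $3$ to elements of $\{1,2,3\}$. The North Cask has type $(p_1.p_2.p_3)$, with word left or right, if for each $i\in\{1,2,3\}$ there is a facet through $N$ in a plane $x_i=\mathrm{const}$, it is a $p_i$-gon, there is a pentagon among these three facets, and each such pentagon is a left (respectively right) pentagon. Here, in the coordinates $(x_{i+1},x_{i+2})$ of the plane $x_i=\mathrm{const}$,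 a left (respectively right) pentagon is an axis-parallel rectangle $[\alpha,\beta]\times[\gamma,\delta]$ with greatest vertex $N$ from which a triangle at the corner $(\alpha,\delta)$ (respectively $(\beta,\gamma)$) has been cut off. Then, for maximal alcoved dodecahedra $\mathcal P(A)$ with $A$ as above: 1. the North Cask has exactly one type, and it depends only on the signs of the three 2-minors $a_{i,4;i-1,i+1}$, $i\in\{1,2,3\}$; 2. the type of the North Cask is either $(\tau(4).\tau(5).\tau(6))$ for some permutation $\tau$ of $\{4,5,6\}$, or $(5.5.5)$ right, or $(5.5.5)$ left; all of these occur, and, with the left/right word counted as part of the type, there are exactly $8$ types (so for $(\tau(4).\tau(5).\tau(6))$ the word is determined by the vector); 3. the $f$-vector of the North Cask is $(f_0,f_1,f_2)=(10,12,3)$. -/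

import Mathlib

/-- A real square matrix is *normal* if it is nonpositive with zero diagonal. -/
def IsNormalMatrix {n : ℕ} (A : Matrix (Fin n) (Fin n) ℝ) : Prop :=
  (∀ i j, A i j ≤ 0) ∧ ∀ i, A i i = 0

/-- *Visualized idempotent* matrices: normal, max-plus idempotent, with zero last row. -/
def IsVisualizedIdempotent {n : ℕ} (A : Matrix (Fin (n + 1)) (Fin (n + 1)) ℝ) : Prop :=
  IsNormalMatrix A ∧ (∀ i j k, A i k + A k j ≤ A i j) ∧ ∀ j, A (Fin.last n) j = 0

/-- The set of all max-plus linear combinations of the columns of `A`. -/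
def tropicalSpan {n : ℕ} (A : Matrix (Fin (n + 1)) (Fin (n + 1)) ℝ) : Set (Fin (n + 1) → ℝ) :=
  {x | ∃ c : Fin (n + 1) → ℝ,
    ∀ i, x i = Finset.univ.sup' Finset.univ_nonempty (fun k => c k + A i k)}

/-- `P(A)`: the section of the tropical span by the hyperplane on which the last coordinate
vanishes, that hyperplane being identified with `ℝⁿ`. -/
def alcovedPolytope {n : ℕ} (A : Matrix (Fin (n + 1)) (Fin (n + 1)) ℝ) : Set (Fin n → ℝ) :=
  {x | Fin.snoc (α := fun _ => ℝ) x 0 ∈ tropicalSpan A}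

/-- The 2-minor `a_{ij;kl}` of `A` (in the sense of differences). -/
def twoMinor {n : ℕ} (A : Matrix (Fin n) (Fin n) ℝ) (i j k l : Fin n) : ℝ :=
  A i k + A j l - A i l - A j k

/-- `F` is a nonempty face of dimension `d` of the polytope `P`. -/
def IsFaceOfDim {n : ℕ} (P : Set (Fin n → ℝ)) (d : ℕ) (F : Set (Fin n → ℝ)) : Prop :=
  IsExposed ℝ P F ∧ F.Nonempty ∧ Module.finrank ℝ (vectorSpan ℝ F) = d

/-- The `f`-vector of a polyhedron in `ℝ³`: the numbers of its vertices, edges and facets. -/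
noncomputable def fVector (P : Set (Fin 3 → ℝ)) : ℕ × ℕ × ℕ :=
  ({F | IsFaceOfDim P 0 F}.ncard, {F | IsFaceOfDim P 1 F}.ncard, {F | IsFaceOfDim P 2 F}.ncard)

/-- Maximal alcoved dodecahedra are those alcoved polyhedra that attain the maximal
`f`-vector `(20, 30, 12)`. -/
def IsMaximalDodecahedron (P : Set (Fin 3 → ℝ)) : Prop :=
  fVector P = (20, 30, 12)

/-- The North Pole is the coordinatewise maximum of the polyhedron. -/
def IsNorthPole (P : Set (Fin 3 → ℝ)) (N : Fin 3 → ℝ) : Prop :=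
  IsGreatest P N

/-- The facets whose union is the North Cask: the facets containing the North Pole. -/
def northCaskFacets (P : Set (Fin 3 → ℝ)) : Set (Set (Fin 3 → ℝ)) :=
  {F | IsFaceOfDim P 2 F ∧ ∃ N, IsNorthPole P N ∧ N ∈ F}

/-- The `d`-dimensional cells of the North Cask (a polyhedral complex): the faces of dimension `d`
of the polyhedron that lie in one of the facets forming the North Cask. -/
def northCaskFaces (P : Set (Fin 3 → ℝ)) (d : ℕ) : Set (Set (Fin 3 → ℝ)) :=
  {G | IsFaceOfDim P d G ∧ ∃ F ∈ northCaskFacets P, G ⊆ F}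

/-- The `f`-vector of the North Cask. -/
noncomputable def northCaskFVector (P : Set (Fin 3 → ℝ)) : ℕ × ℕ × ℕ :=
  ((northCaskFaces P 0).ncard, (northCaskFaces P 1).ncard, (northCaskFaces P 2).ncard)

/-- A facet (a two-dimensional polytope) is a `p`-gon if it has `p` vertices. -/
def IsGon (p : ℕ) (F : Set (Fin 3 → ℝ)) : Prop :=
  Module.finrank ℝ (vectorSpan ℝ F) = 2 ∧ {v | IsFaceOfDim F 0 v}.ncard = p

/-- The two chirality words. -/
inductive Chirality
  | left
  | right

/-- `S ⊆ ℝ²` is a pentagon, left or right according to the chirality, with respect to `V`: it is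
obtained from an axis-parallel rectangle with minimum `a` and maximum `V` by cutting off a right
triangle with legs `h` (horizontal) and `v` (vertical) at a corner not opposite to `V`. The corner
cut off is the left one `(a.1, V.2)`, respectively the right one `(V.1, a.2)`. -/
def IsPentagonAtMax (c : Chirality) (V : ℝ × ℝ) (S : Set (ℝ × ℝ)) : Prop :=
  ∃ (a : ℝ × ℝ) (h v : ℝ), 0 < h ∧ h < V.1 - a.1 ∧ 0 < v ∧ v < V.2 - a.2 ∧
    match c with
    | .left => S = {z | z ∈ Set.Icc a V ∧ 1 ≤ (z.1 - a.1) / h + (V.2 - z.2) / v}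
    | .right => S = {z | z ∈ Set.Icc a V ∧ 1 ≤ (V.1 - z.1) / h + (z.2 - a.2) / v}

/-- Cartesian coordinates `(x_{i+1}, x_{i+2})`, indices modulo 3, on a plane `x_i = const`. They
are positively oriented when the plane is viewed from the side where `x_i` is larger, which is the
outer side for a facet through the North Pole. -/
def planeCoords (i : Fin 3) (x : Fin 3 → ℝ) : ℝ × ℝ :=
  (x (i + 1), x (i + 2))

/-- A type of a polar cask: a vector `(p.q.r)` and a chirality word. -/
structure CaskType where
  vector : Fin 3 → ℕ
  word : Chirality

/-- The North Cask of `P` has type `t`: for each `i` there is a facet through the North Pole that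
lies in a plane `x_i = const`; it is a `t.vector i`-gon; pentagons occur among these three facets,
and every one of them has the chirality given by the word of `t`. -/
def HasNorthCaskType (P : Set (Fin 3 → ℝ)) (t : CaskType) : Prop :=
  ∃ N, IsNorthPole P N ∧ (∃ i, t.vector i = 5) ∧
    ∀ i, ∃ F ∈ northCaskFacets P, (∀ x ∈ F, x i = N i) ∧ IsGon (t.vector i) F ∧
      (t.vector i = 5 → IsPentagonAtMax t.word (planeCoords i N) (planeCoords i '' F))

/-- The signs of the three 2-minors `a_{i,4;i-1,i+1}`, where `i - 1` and `i + 1` are reduced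
modulo 3. The indices 1, 2, 3, 4 of the matrix are represented by `0, 1, 2, 3 : Fin 4`. -/
noncomputable def northSigns (A : Matrix (Fin 4) (Fin 4) ℝ) (i : Fin 3) : SignType :=
  SignType.sign
    (twoMinor A i.castSucc (Fin.last 3) (i - 1).castSucc (i + 1).castSucc)

/-!
The idea is to replace the faces of `P(A)` by combinatorial data. With `b i j = -a_ij` and
homogeneous coordinates `x_4 = 0`, the polyhedron is given by the twelve inequalities
`x_j - x_i ≤ b i j`, indexed by the arcs `(i, j)` of the complete digraph on four vertices; the
vertices are numbered `0, 1, 2, 3` here. For any polyhedron given by finitely many inequalities, the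
nonempty exposed faces correspond to the active sets of its points, and the dimension of a face is
the dimension of the common kernel of its active functionals (`isFaceOfDim_faceOf_iff`).

If `P(A)` has 12 facets, then each inequality is the only active one at some point, and this makes
all triangle inequalities between the `b i j` strict (`strictTriangle_of_ncard_facets`). Active sets
then contain no path of length two, and the active set of an edge is a pair of arcs. There are 36
pairs without a path, and exchanging heads, `{ij, km} ↦ {im, kj}`, matches up the 12 pairs of
disjoint arcs; comparing `b i j + b k m` with `b i m + b k j` shows that at most one pair of each
couple is active along an edge, and neither is if the sums agree. So 30 edges force all 2-minors to
be nonzero (`nonzeroMinors_of_ncard_edges`).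

For such a generic matrix the active sets are exactly the cliques of a compatibility relation
between arcs, and a clique with `k` arcs is a face of dimension `3 - k`
(`mem_activeSets_iff_isClique`): a clique is a forest, it lies in a star or in a path with three
edges, these trees belong to simple vertices, and every subset of the active set of a simple vertex
is an active set.

The North Pole is the origin, and the faces of the North Cask are the cliques that contain an arc
leaving the last vertex. These cliques depend only on the signs of the three 2-minors
`a_{i,4;i-1,i+1}`, called northern (`IsGeneric.isClique_iff`), so they can be
counted in one integral model for each of the eight sign patterns. The facet in
the plane `x_i = 0` is a rectangle, cut at one corner if the minor of `i + 1` is negative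
and at the opposite one if the minor of `i + 2` is positive. Hence it is a pentagon
exactly when these two signs agree, it is then left for negative signs and right for positive ones,
and all the pentagons of the cask follow the majority of the three signs. The same integral models
show that all eight patterns occur.
-/

/-! ### Faces of polyhedra given by finitely many inequalities -/

section Polyhedron

open Filter Topology

variable {n : ℕ} {ι : Type*} (f : ι → (Fin n → ℝ) →L[ℝ] ℝ) (β : ι → ℝ)

/-- The polyhedron of the points `x` with `f c x ≤ β c` for all `c`. -/
def polyhedron : Set (Fin n → ℝ) := {x | ∀ c, f c x ≤ β c}

open Classical in
/-- The set of the inequalities that hold with equality at `x`. -/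
noncomputable def activeSet [Fintype ι] (x : Fin n → ℝ) : Finset ι :=
  Finset.univ.filter fun c => f c x = β c

/-- The points of the polyhedron at which every inequality of `S` holds with equality. -/
def faceOf (S : Finset ι) : Set (Fin n → ℝ) := {x | x ∈ polyhedron f β ∧ ∀ c ∈ S, f c x = β c}

/-- The intersection of the kernels of the functionals indexed by `S`. -/
def commonKer (S : Finset ι) : Submodule ℝ (Fin n → ℝ) := ⨅ c ∈ S, (f c).ker

/-- The active sets of the points of the polyhedron. -/
def activeSets [Fintype ι] : Set (Finset ι) := activeSet f β '' polyhedron f β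

/-- The functionals indexed by `S` take arbitrary prescribed values simultaneously. -/
def IsFreeSystem (S : Finset ι) : Prop := ∀ g : ι → ℝ, ∃ v, ∀ c ∈ S, f c v = g c

variable {f β}

@[simp]
lemma mem_activeSet [Fintype ι] {x : Fin n → ℝ} {c : ι} : c ∈ activeSet f β x ↔ f c x = β c := by
  simp [activeSet]

lemma mem_commonKer {S : Finset ι} {v : Fin n → ℝ} : v ∈ commonKer f S ↔ ∀ c ∈ S, f c v = 0 := by
  simp [commonKer]

lemma commonKer_anti {S T : Finset ι} (h : S ⊆ T) : commonKer f T ≤ commonKer f S :=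
  fun _ hv => mem_commonKer.2 fun c hc => mem_commonKer.1 hv c (h hc)

lemma mem_faceOf_iff [Fintype ι] {x : Fin n → ℝ} {S : Finset ι} :
    x ∈ faceOf f β S ↔ x ∈ polyhedron f β ∧ S ⊆ activeSet f β x := by
  simp [faceOf, Finset.subset_iff]

lemma faceOf_empty : faceOf f β ∅ = polyhedron f β := by
  ext; simp [faceOf]

lemma convex_faceOf (S : Finset ι) : Convex ℝ (faceOf f β S) := by
  rintro x ⟨hx, hxS⟩ y ⟨hy, hyS⟩ a b ha hb hab
  refine ⟨fun c => ?_, fun c hc => ?_⟩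
  · simp only [map_add, map_smul, smul_eq_mul]
    calc a * f c x + b * f c y ≤ a * β c + b * β c := by gcongr; exacts [hx c, hy c]
      _ = β c := by rw [← add_mul, hab, one_mul]
  · simp only [map_add, map_smul, smul_eq_mul, hxS c hc, hyS c hc]
    rw [← add_mul, hab, one_mul]

/-- The sum of the functionals indexed by `S` exposes `faceOf f β S`. -/
lemma isExposed_faceOf {S₀ S : Finset ι} (h : S₀ ⊆ S) :
    IsExposed ℝ (faceOf f β S₀) (faceOf f β S) := by
  rintro ⟨z, hz, hzS⟩
  refine ⟨∑ c ∈ S, f c, ?_⟩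
  have hsum : ∀ y : Fin n → ℝ, (∑ c ∈ S, f c) y = ∑ c ∈ S, f c y := fun y => by simp
  ext x
  simp only [Set.mem_ofPred_eq, hsum]
  constructor
  · rintro ⟨hx, hxS⟩
    refine ⟨⟨hx, fun c hc => hxS c (h hc)⟩, fun y hy => ?_⟩
    exact Finset.sum_le_sum fun c hc => (hy.1 c).trans (hxS c hc).ge
  · rintro ⟨hx, hmax⟩
    refine ⟨hx.1, (Finset.sum_eq_sum_iff_of_le fun c _ => hx.1 c).1 (le_antisymm
      (Finset.sum_le_sum fun c _ => hx.1 c) ?_)⟩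
    rw [← Finset.sum_congr rfl hzS]
    exact hmax z ⟨hz, fun c hc => hzS c (h hc)⟩

lemma IsFreeSystem.finrank_commonKer {S : Finset ι} (hS : IsFreeSystem f S) :
    Module.finrank ℝ (commonKer f S) + S.card = n := by
  let L : (Fin n → ℝ) →ₗ[ℝ] (S → ℝ) := LinearMap.pi fun c => (f c : (Fin n → ℝ) →ₗ[ℝ] ℝ)
  have hker : LinearMap.ker L = commonKer f S := by
    ext v
    simp [L, mem_commonKer, funext_iff]
  have hrange : LinearMap.range L = ⊤ := by
    classical
    refine LinearMap.range_eq_top.2 fun g => ?_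
    obtain ⟨v, hv⟩ := hS fun c => if h : c ∈ S then g ⟨c, h⟩ else 0
    exact ⟨v, funext fun c => by simpa [L] using hv c c.2⟩
  have := LinearMap.finrank_range_add_finrank_ker L
  rw [hker, hrange, finrank_top] at this
  simp at this
  lia

variable [Fintype ι]

/-- A small step in a direction along which no active functional increases stays in the
polyhedron and keeps exactly those inequalities active whose functional vanishes on it. -/
lemma exists_perturbation {x v : Fin n → ℝ} (hx : x ∈ polyhedron f β)
    (hv : ∀ c ∈ activeSet f β x, f c v ≤ 0) :
    ∃ ε : ℝ, 0 < ε ∧ x + ε • v ∈ polyhedron f β ∧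
      ∀ c, c ∈ activeSet f β (x + ε • v) ↔ c ∈ activeSet f β x ∧ f c v = 0 := by
  have hev : ∀ᶠ ε : ℝ in 𝓝[>] 0, ∀ c, c ∉ activeSet f β x → f c (x + ε • v) < β c := by
    refine eventually_all.2 fun c => ?_
    by_cases hc : c ∈ activeSet f β x
    · simp [hc]
    · have hlt : f c (x + (0 : ℝ) • v) < β c := by
        simpa using lt_of_le_of_ne (hx c) (by simpa using hc)
      have hcont : Continuous fun ε : ℝ => f c (x + ε • v) := by fun_prop
      filter_upwards [nhdsWithin_le_nhds (hcont.continuousAt.eventually_lt_const hlt)] with ε hε _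
      exact hε
  obtain ⟨ε, hε, hpos⟩ := (hev.and self_mem_nhdsWithin).exists
  have hpos : 0 < ε := hpos
  have hval : ∀ c, c ∈ activeSet f β x → f c (x + ε • v) = β c + ε * f c v := fun c hc => by
    rw [map_add, map_smul, smul_eq_mul, mem_activeSet.1 hc]
  refine ⟨ε, hpos, fun c => ?_, fun c => ?_⟩
  · by_cases hc : c ∈ activeSet f β x
    · have := mul_nonpos_of_nonneg_of_nonpos hpos.le (hv c hc)
      linarith [hval c hc]
    · exact (hε c hc).le
  · by_cases hc : c ∈ activeSet f β x
    · rw [mem_activeSet, hval c hc]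
      simp [hpos.ne', mem_activeSet.1 hc]
    · simp only [hc, false_and, iff_false, mem_activeSet]
      exact (hε c hc).ne

/-- A point of an exposed face with as few active inequalities as possible lies in its relative
interior, so its active inequalities cut out the whole face. -/
lemma exists_eq_faceOf_of_isExposed {S₀ : Finset ι} {F : Set (Fin n → ℝ)}
    (hF : IsExposed ℝ (faceOf f β S₀) F) (hne : F.Nonempty) :
    ∃ x ∈ faceOf f β S₀, F = faceOf f β (activeSet f β x) := by
  classical
  obtain ⟨x, hxF, hmin⟩ : ∃ x ∈ F, ∀ z ∈ F, (activeSet f β x).card ≤ (activeSet f β z).card := by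
    obtain ⟨x, hx, hm⟩ :=
      (InvImage.wf (fun z => (activeSet f β z).card) wellFounded_lt).has_min F hne
    exact ⟨x, hx, fun z hz => not_lt.1 (hm z hz)⟩
  have hxS := hF.subset hxF
  refine ⟨x, hxS, Set.Subset.antisymm (fun z hz => ?_) fun z hz => ?_⟩
  · have hzS := hF.subset hz
    have hm : (1 / 2 : ℝ) • x + (1 / 2 : ℝ) • z ∈ F :=
      hF.convex (convex_faceOf S₀) hxF hz (by norm_num) (by norm_num) (by norm_num)
    have hsub : activeSet f β ((1 / 2 : ℝ) • x + (1 / 2 : ℝ) • z) ⊆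
        activeSet f β x ∩ activeSet f β z := fun c hc => by
      rw [mem_activeSet] at hc
      simp only [map_add, map_smul, smul_eq_mul] at hc
      have h1 := hxS.1 c
      have h2 := hzS.1 c
      rw [Finset.mem_inter, mem_activeSet, mem_activeSet]
      constructor <;> linarith
    have heq := Finset.eq_of_subset_of_card_le (hsub.trans Finset.inter_subset_left) (hmin _ hm)
    exact mem_faceOf_iff.2 ⟨hzS.1, heq ▸ hsub.trans Finset.inter_subset_right⟩
  · -- `x` lies strictly between `z` and a point of `faceOf f β S₀`, so a functional that is
    -- maximal at `x` is maximal at `z` too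
    obtain ⟨l, hl⟩ := hF hne
    have hz' := mem_faceOf_iff.1 hz
    obtain ⟨ε, hε, hP, hact⟩ := exists_perturbation (v := x - z) hxS.1 fun c hc => by
      rw [map_sub, mem_activeSet.1 hc, hz.2 c hc, sub_self]
    have hS₀ := (mem_faceOf_iff.1 hxS).2
    have hyS : x + ε • (x - z) ∈ faceOf f β S₀ := mem_faceOf_iff.2 ⟨hP, fun c hc =>
      (hact c).2 ⟨hS₀ hc, by rw [map_sub, mem_activeSet.1 (hS₀ hc), hz.2 c (hS₀ hc), sub_self]⟩⟩
    have hxl : ∀ y ∈ faceOf f β S₀, l y ≤ l x := (hl ▸ hxF : x ∈ {x ∈ _ | _}).2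
    have h1 := hxl _ hyS
    simp only [map_add, map_smul, map_sub, smul_eq_mul] at h1
    have h2 : l x ≤ l z := by
      by_contra h
      have := mul_pos hε (sub_pos.2 (not_le.1 h))
      linarith
    rw [hl]
    exact ⟨mem_faceOf_iff.2 ⟨hz'.1, hS₀.trans hz'.2⟩, fun y hy => (hxl y hy).trans h2⟩

lemma vectorSpan_faceOf {x : Fin n → ℝ} (hx : x ∈ polyhedron f β) :
    vectorSpan ℝ (faceOf f β (activeSet f β x)) = commonKer f (activeSet f β x) := by
  have hxx : x ∈ faceOf f β (activeSet f β x) := mem_faceOf_iff.2 ⟨hx, subset_rfl⟩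
  apply le_antisymm
  · rw [vectorSpan_def, Submodule.span_le]
    rintro _ ⟨y, hy, z, hz, rfl⟩
    refine mem_commonKer.2 fun c hc => ?_
    simp [vsub_eq_sub, hy.2 c hc, hz.2 c hc]
  · intro v hv
    rw [mem_commonKer] at hv
    obtain ⟨ε, hε, hP, hact⟩ := exists_perturbation (v := v) hx fun c hc => (hv c hc).le
    have hmem : x + ε • v ∈ faceOf f β (activeSet f β x) :=
      mem_faceOf_iff.2 ⟨hP, fun c hc => (hact c).2 ⟨hc, hv c hc⟩⟩
    have := Submodule.smul_mem _ ε⁻¹ (vsub_mem_vectorSpan ℝ hmem hxx)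
    simpa [vsub_eq_sub, smul_smul, hε.ne'] using this

/-- The nonempty faces of `faceOf f β S₀` correspond to the active sets containing `S₀`. -/
lemma isFaceOfDim_faceOf_iff {S₀ : Finset ι} {d : ℕ} {F : Set (Fin n → ℝ)} :
    IsFaceOfDim (faceOf f β S₀) d F ↔ ∃ S ∈ activeSets f β, S₀ ⊆ S ∧
      Module.finrank ℝ (commonKer f S) = d ∧ faceOf f β S = F := by
  constructor
  · rintro ⟨hexp, hne, hd⟩
    obtain ⟨x, hx, rfl⟩ := exists_eq_faceOf_of_isExposed hexp hne
    rw [mem_faceOf_iff] at hx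
    rw [vectorSpan_faceOf hx.1] at hd
    exact ⟨_, ⟨x, hx.1, rfl⟩, hx.2, hd, rfl⟩
  · rintro ⟨_, ⟨x, hx, rfl⟩, hsub, hd, rfl⟩
    exact ⟨isExposed_faceOf hsub, ⟨x, mem_faceOf_iff.2 ⟨hx, subset_rfl⟩⟩,
      by rw [vectorSpan_faceOf hx, hd]⟩

lemma faceOf_subset_faceOf_iff {S T : Finset ι} (hS : S ∈ activeSets f β) :
    faceOf f β S ⊆ faceOf f β T ↔ T ⊆ S := by
  obtain ⟨x, hx, rfl⟩ := hS
  constructor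
  · exact fun h => (mem_faceOf_iff.1 (h (mem_faceOf_iff.2 ⟨hx, subset_rfl⟩))).2
  · exact fun h y hy => ⟨hy.1, fun c hc => hy.2 c (h hc)⟩

lemma injOn_faceOf : Set.InjOn (faceOf f β) (activeSets f β) := fun _ hS _ hT h =>
  subset_antisymm ((faceOf_subset_faceOf_iff hT).1 h.ge) ((faceOf_subset_faceOf_iff hS).1 h.le)

lemma ncard_image_faceOf {𝒮 : Set (Finset ι)} (h : 𝒮 ⊆ activeSets f β) :
    (faceOf f β '' 𝒮).ncard = 𝒮.ncard :=
  (injOn_faceOf.mono h).ncard_image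

/-- A face of the given dimension is determined by any subset of its active inequalities that
already has the right rank. -/
lemma eq_of_subset_of_finrank_eq {R S T : Finset ι} (hS : S ∈ activeSets f β)
    (hT : T ∈ activeSets f β) (hRS : R ⊆ S) (hRT : R ⊆ T)
    (hdS : Module.finrank ℝ (commonKer f S) = Module.finrank ℝ (commonKer f R))
    (hdT : Module.finrank ℝ (commonKer f T) = Module.finrank ℝ (commonKer f R)) : S = T := by
  have key : ∀ x y : Fin n → ℝ, R ⊆ activeSet f β x → R ⊆ activeSet f β y →
      Module.finrank ℝ (commonKer f (activeSet f β x)) = Module.finrank ℝ (commonKer f R) →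
      activeSet f β x ⊆ activeSet f β y := by
    intro x y hx hy hd c hc
    have heq := Submodule.eq_of_le_of_finrank_eq (commonKer_anti (f := f) hx) hd
    have hmem : x - y ∈ commonKer f R := mem_commonKer.2 fun c hc => by
      rw [map_sub, mem_activeSet.1 (hx hc), mem_activeSet.1 (hy hc), sub_self]
    rw [← heq, mem_commonKer] at hmem
    have := hmem c hc
    rw [map_sub, mem_activeSet.1 hc] at this
    rw [mem_activeSet]
    linarith
  obtain ⟨x, -, rfl⟩ := hS
  obtain ⟨y, -, rfl⟩ := hT
  exact subset_antisymm (key x y hRS hRT hdS) (key y x hRT hRS hdT)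

/-- At a simple point, every subset of the active set is the active set of some point. -/
lemma IsFreeSystem.mem_activeSets {S T : Finset ι} (hT : IsFreeSystem f T)
    (hmem : T ∈ activeSets f β) (h : S ⊆ T) : S ∈ activeSets f β := by
  classical
  obtain ⟨x, hx, rfl⟩ := hmem
  obtain ⟨v, hv⟩ := hT fun c => if c ∈ S then 0 else -1
  obtain ⟨ε, -, hP, hact⟩ := exists_perturbation (v := v) hx fun c hc => by
    rw [hv c hc]; split_ifs <;> norm_num
  refine ⟨_, hP, Finset.ext fun c => (hact c).trans ⟨fun hc => ?_, fun hc => ⟨h hc, ?_⟩⟩⟩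
  · by_contra hcS
    have h1 := hv c hc.1
    rw [hc.2, if_neg hcS] at h1
    norm_num at h1
  · rw [hv c (h hc), if_pos hc]

/-- If there are as many facets as inequalities, then every inequality defines a facet. -/
lemma singleton_mem_activeSets [DecidableEq ι] (hsol : ∀ c, IsFreeSystem f {c}) {d : ℕ}
    (hd : d + 1 = n)
    (hcard : {S | S ∈ activeSets f β ∧ Module.finrank ℝ (commonKer f S) = d}.ncard =
      Fintype.card ι) (c : ι) : {c} ∈ activeSets f β := by
  set 𝓕 := {S | S ∈ activeSets f β ∧ Module.finrank ℝ (commonKer f S) = d} with h𝓕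
  have hker : ∀ c, Module.finrank ℝ (commonKer f {c}) = d := fun c => by
    have := (hsol c).finrank_commonKer
    simp at this
    lia
  -- distinct members of `𝓕` are disjoint
  have hdisj : ∀ S ∈ 𝓕, ∀ T ∈ 𝓕, ∀ c, c ∈ S → c ∈ T → S = T := fun S hS T hT c hcS hcT =>
    eq_of_subset_of_finrank_eq (R := {c}) hS.1 hT.1 (by simpa) (by simpa)
      (by rw [hS.2, hker]) (by rw [hT.2, hker])
  have hne : ∀ S : 𝓕, S.1.Nonempty := fun S => by
    by_contra h
    have h0 : IsFreeSystem f (∅ : Finset ι) := fun _ => ⟨0, by simp⟩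
    have h1 := h0.finrank_commonKer
    have h2 := S.2.2
    rw [Finset.not_nonempty_iff_eq_empty.1 h] at h2
    simp at h1
    lia
  choose g hg using hne
  have hinj : Function.Injective g := fun S T hST =>
    Subtype.ext (hdisj S S.2 T T.2 (g S) (hg S) (hST ▸ hg T))
  have := Fintype.ofFinite 𝓕
  have hbij : Function.Bijective g := by
    refine (Fintype.bijective_iff_injective_and_card g).2 ⟨hinj, ?_⟩
    rw [← hcard, ← Nat.card_coe_set_eq, Nat.card_eq_fintype_card]
  obtain ⟨S, rfl⟩ := hbij.2 c
  convert S.2.1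
  refine (Finset.eq_singleton_iff_unique_mem.2 ⟨hg S, fun c' hc' => ?_⟩).symm
  obtain ⟨T, rfl⟩ := hbij.2 c'
  rw [Subtype.ext (hdisj S S.2 T T.2 _ hc' (hg T))]

end Polyhedron

/-! ### Alcoved polyhedra in space -/

/-- The arcs of the complete digraph on four vertices. They index the twelve inequalities that
define an alcoved polyhedron in `ℝ³`. -/
abbrev Arc := {p : Fin 4 × Fin 4 // p.1 ≠ p.2}

/-- The homogeneous coordinates on `ℝ³`: the last one is `0`. -/
noncomputable def homCoord (i : Fin 4) : (Fin 3 → ℝ) →L[ℝ] ℝ :=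
  Fin.lastCases (motive := fun _ => (Fin 3 → ℝ) →L[ℝ] ℝ) 0
    (fun i => ContinuousLinearMap.proj (R := ℝ) (φ := fun _ : Fin 3 => ℝ) i) i

/-- The difference of homogeneous coordinates `x_j - x_i` along the arc from `i` to `j`. -/
noncomputable def arcForm (c : Arc) : (Fin 3 → ℝ) →L[ℝ] ℝ := homCoord c.1.2 - homCoord c.1.1

/-- The entry of a matrix at an arc. -/
def arcBound (b : Fin 4 → Fin 4 → ℝ) (c : Arc) : ℝ := b c.1.1 c.1.2

@[simp] lemma homCoord_last (x : Fin 3 → ℝ) : homCoord 3 x = 0 := by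
  have : (3 : Fin 4) = Fin.last 3 := rfl
  rw [this, homCoord, Fin.lastCases_last]; rfl

@[simp] lemma homCoord_castSucc (i : Fin 3) (x : Fin 3 → ℝ) : homCoord i.castSucc x = x i := by
  rw [homCoord, Fin.lastCases_castSucc]; rfl

lemma exists_homCoord_eq (w : Fin 4 → ℝ) : ∃ x, ∀ i, homCoord i x = w i - w 3 := by
  refine ⟨fun i => w i.castSucc - w 3, fun i => ?_⟩
  induction i using Fin.lastCases with
  | last => exact (homCoord_last _).trans (sub_self (w 3)).symm
  | cast i => simp

lemma arcForm_apply (c : Arc) (x : Fin 3 → ℝ) :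
    arcForm c x = homCoord c.1.2 x - homCoord c.1.1 x := rfl

section Alcoved

variable {b : Fin 4 → Fin 4 → ℝ}

lemma mem_alcoved_iff {x : Fin 3 → ℝ} : x ∈ polyhedron arcForm (arcBound b) ↔
    ∀ i j, i ≠ j → homCoord j x - homCoord i x ≤ b i j :=
  ⟨fun h i j hij => h ⟨(i, j), hij⟩, fun h c => h _ _ c.2⟩

lemma mem_active_iff {x : Fin 3 → ℝ} {c : Arc} : c ∈ activeSet arcForm (arcBound b) x ↔
    homCoord c.1.2 x - homCoord c.1.1 x = b c.1.1 c.1.2 := by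
  rw [mem_activeSet]; rfl

/-- No arc of `S` ends where another one starts. -/
def NoPath (S : Finset Arc) : Prop := ∀ c ∈ S, ∀ d ∈ S, c.1.1 ≠ d.1.2

instance : DecidablePred NoPath := fun S => by unfold NoPath; infer_instance

lemma NoPath.mono {S T : Finset Arc} (hT : NoPath T) (h : S ⊆ T) : NoPath S :=
  fun c hc d hd => hT c (h hc) d (h hd)

/-- All triangle inequalities between the entries of `b` are strict. -/
def StrictTriangle (b : Fin 4 → Fin 4 → ℝ) : Prop :=
  ∀ i j k, i ≠ j → i ≠ k → k ≠ j → b i j < b i k + b k j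

/-- No 2-minor of `b` without diagonal entries vanishes. -/
def NonzeroMinors (b : Fin 4 → Fin 4 → ℝ) : Prop :=
  ∀ i j k m, i ≠ j → i ≠ k → i ≠ m → j ≠ k → j ≠ m → k ≠ m → b i j + b k m ≠ b i m + b k j

lemma StrictTriangle.pos (hb : StrictTriangle b) {i j : Fin 4} (hij : i ≠ j) :
    0 < b i j + b j i := by
  obtain ⟨k, hki, hkj⟩ : ∃ k, k ≠ i ∧ k ≠ j := by revert i j; decide
  have h1 := hb k i j hki hkj hij.symm
  have h2 := hb k j i hkj hki hij
  linarith

lemma StrictTriangle.noPath (hb : StrictTriangle b) {S : Finset Arc}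
    (hS : S ∈ activeSets arcForm (arcBound b)) : NoPath S := by
  obtain ⟨x, hx, rfl⟩ := hS
  rintro ⟨⟨i, j⟩, hij⟩ hc ⟨⟨k, m⟩, hkm⟩ hd h
  rw [mem_active_iff] at hc hd
  dsimp only at *
  subst h
  by_cases hkj : k = j
  · subst hkj
    linarith [hb.pos hij]
  · have h1 := mem_alcoved_iff.1 hx k j hkj
    have h2 := hb k j i hkj hkm hij
    linarith

/-- Exchanging the heads of two active arcs: the sum of the entries cannot decrease, and if it
stays the same, then the new arcs are active too. -/
lemma swap_active {x : Fin 3 → ℝ} (hx : x ∈ polyhedron arcForm (arcBound b)) {c d : Arc}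
    (hc : c ∈ activeSet arcForm (arcBound b) x) (hd : d ∈ activeSet arcForm (arcBound b) x)
    (hcd : c.1.1 ≠ d.1.2) (hdc : d.1.1 ≠ c.1.2) :
    b c.1.1 c.1.2 + b d.1.1 d.1.2 ≤ b c.1.1 d.1.2 + b d.1.1 c.1.2 ∧
      (b c.1.1 c.1.2 + b d.1.1 d.1.2 = b c.1.1 d.1.2 + b d.1.1 c.1.2 →
        (⟨(c.1.1, d.1.2), hcd⟩ : Arc) ∈ activeSet arcForm (arcBound b) x ∧
        (⟨(d.1.1, c.1.2), hdc⟩ : Arc) ∈ activeSet arcForm (arcBound b) x) := by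
  rw [mem_active_iff] at hc hd
  have h1 := mem_alcoved_iff.1 hx _ _ hcd
  have h2 := mem_alcoved_iff.1 hx _ _ hdc
  refine ⟨by linarith, fun h => ⟨?_, ?_⟩⟩ <;> rw [mem_active_iff] <;> dsimp only <;> linarith

/-! ### Forests of arcs -/

/-- `S` contains no path of length two and no alternating 4-cycle. -/
def IsForest (S : Finset Arc) : Prop :=
  NoPath S ∧ ∀ c ∈ S, ∀ d ∈ S, c.1.1 ≠ d.1.1 → c.1.2 ≠ d.1.2 →
    ∀ e ∈ S, ∀ e' ∈ S, e.1 = (c.1.1, d.1.2) → e'.1 ≠ (d.1.1, c.1.2)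

lemma forall_eq_or {i j k m : Fin 4} (hij : i ≠ j) (hik : i ≠ k) (him : i ≠ m) (hjk : j ≠ k)
    (hjm : j ≠ m) (hkm : k ≠ m) (p : Fin 4) : p = i ∨ p = j ∨ p = k ∨ p = m := by
  revert i j k m p; decide

/-- A forest of arcs on four vertices lies in an out-star, in an in-star, or in a path with three
edges that contains both end edges of the path. -/
lemma IsForest.cases {S : Finset Arc} (hS : IsForest S) :
    (∃ i, ∀ c ∈ S, c.1.1 = i) ∨ (∃ j, ∀ c ∈ S, c.1.2 = j) ∨
    ∃ i j k m, ∃ (hij : i ≠ j) (hkm : k ≠ m), i ≠ k ∧ i ≠ m ∧ j ≠ k ∧ j ≠ m ∧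
      (⟨(i, j), hij⟩ : Arc) ∈ S ∧ (⟨(k, m), hkm⟩ : Arc) ∈ S ∧
      ∀ c ∈ S, c.1 = (i, j) ∨ c.1 = (i, m) ∨ c.1 = (k, m) := by
  by_cases hdisj : ∃ c ∈ S, ∃ d ∈ S, c.1.1 ≠ d.1.1 ∧ c.1.2 ≠ d.1.2
  · obtain ⟨⟨⟨i, j⟩, hij⟩, hc, ⟨⟨k, m⟩, hkm⟩, hd, hik, hjm⟩ := hdisj
    have him := hS.1 _ hc _ hd
    have hkj := hS.1 _ hd _ hc
    dsimp only at *
    have hcases : ∀ e ∈ S, e.1 = (i, j) ∨ e.1 = (i, m) ∨ e.1 = (k, m) ∨ e.1 = (k, j) := by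
      rintro ⟨⟨p, q⟩, hpq⟩ he
      have h1 := hS.1 _ he _ hc
      have h2 := hS.1 _ he _ hd
      have h3 := hS.1 _ hc _ he
      have h4 := hS.1 _ hd _ he
      have hp := forall_eq_or hij hik him hkj.symm hjm hkm p
      have hq := forall_eq_or hij hik him hkj.symm hjm hkm q
      dsimp only at *
      rcases hp with rfl | rfl | rfl | rfl <;> rcases hq with rfl | rfl | rfl | rfl <;> simp_all
    by_cases hmid : ∃ e ∈ S, e.1 = (k, j)
    · obtain ⟨e, he, hekj⟩ := hmid
      refine .inr (.inr ⟨k, m, i, j, hkm, hij, hik.symm, hkj, him.symm, hjm.symm, hd, hc, ?_⟩)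
      intro e' he'
      have := fun h => hS.2 _ hc _ hd hik hjm e' he' e he h hekj
      have := hcases e' he'
      tauto
    · refine .inr (.inr ⟨i, j, k, m, hij, hkm, hik, him, hkj.symm, hjm, hc, hd, ?_⟩)
      intro e' he'
      have := fun h => hmid ⟨e', he', h⟩
      have := hcases e' he'
      tauto
  · push Not at hdisj
    rcases S.eq_empty_or_nonempty with rfl | ⟨c, hc⟩
    · exact .inl ⟨0, by simp⟩
    by_cases hstar : ∀ d ∈ S, d.1.1 = c.1.1
    · exact .inl ⟨_, hstar⟩
    · push Not at hstar
      obtain ⟨d, hd, hdc⟩ := hstar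
      refine .inr (.inl ⟨c.1.2, fun e he => ?_⟩)
      by_contra hne
      have h1 := mt (hdisj e he c hc) hne
      have h2 := hdisj c hc d hd hdc.symm
      have h3 := mt (hdisj e he d hd) (h2 ▸ hne)
      rw [not_not] at h1 h3
      exact hdc (h3.symm.trans h1)

/-- The functionals of a forest are linearly independent. -/
lemma IsForest.isFreeSystem {S : Finset Arc} (hS : IsForest S) : IsFreeSystem arcForm S := by
  intro g
  let h : Fin 4 → Fin 4 → ℝ := fun i j => if hij : i = j then 0 else g ⟨(i, j), hij⟩
  have hh : ∀ c : Arc, g c = h c.1.1 c.1.2 := fun c => by simp [h, c.2]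
  rcases hS.cases with ⟨i, hi⟩ | ⟨j, hj⟩ | ⟨i, j, k, m, hij, hkm, hik, him, hjk, hjm, -, -, hc⟩
  · obtain ⟨v, hv⟩ := exists_homCoord_eq (h i)
    refine ⟨v, fun c hc => ?_⟩
    rw [arcForm_apply, hv, hv, hh, hi c hc]
    simp [h]
  · obtain ⟨v, hv⟩ := exists_homCoord_eq fun i => -h i j
    refine ⟨v, fun c hc => ?_⟩
    rw [arcForm_apply, hv, hv, hh, hj c hc]
    simp [h]
  · obtain ⟨v, hv⟩ := exists_homCoord_eq fun p => if p = j then h i j else if p = m then h i m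
      else if p = k then h i m - h k m else 0
    refine ⟨v, fun c hcS => ?_⟩
    rw [arcForm_apply, hv, hv, hh]
    rcases hc c hcS with h1 | h1 | h1 <;> rw [h1] <;>
      simp [hij, hkm, hik, him, hjm.symm, hjk.symm]

lemma NoPath.isForest {S : Finset Arc} (hS : NoPath S) (hcard : S.card ≤ 3) : IsForest S := by
  refine ⟨hS, fun c hc d hd h1 h2 e he e' he' hec hed => ?_⟩
  have hsub : ({c, d, e, e'} : Finset Arc) ⊆ S := by
    simp [Finset.insert_subset_iff, hc, hd, he, he']
  have hcd : c ≠ d := fun h => h1 (by rw [h])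
  have hce : c ≠ e := fun h => h2 (by rw [h, hec])
  have hce' : c ≠ e' := fun h => h1 (by rw [h, hed])
  have hde : d ≠ e := fun h => h1 (by rw [h, hec])
  have hde' : d ≠ e' := fun h => h2 (by rw [h, hed])
  have hee' : e ≠ e' := fun h => h1 (by
    have := congrArg Prod.fst (hec.symm.trans ((congrArg Subtype.val h).trans hed))
    exact this)
  have := Finset.card_le_card hsub
  rw [Finset.card_insert_of_notMem (by simp [*]), Finset.card_insert_of_notMem (by simp [*]),
    Finset.card_insert_of_notMem (by simp [*]), Finset.card_singleton] at this
  lia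

/-! ### Active sets of generic alcoved polyhedra -/

/-- Two arcs are compatible if neither ends where the other one starts and, unless they have an
end in common, exchanging their heads increases the sum of the entries. -/
def IsCompatible {α : Type*} [Add α] [LT α] (b : Fin 4 → Fin 4 → α) (c d : Arc) : Prop :=
  c.1.1 ≠ d.1.2 ∧ d.1.1 ≠ c.1.2 ∧ (c.1.1 = d.1.1 ∨ c.1.2 = d.1.2 ∨
    b c.1.1 c.1.2 + b d.1.1 d.1.2 < b c.1.1 d.1.2 + b d.1.1 c.1.2)

/-- The arcs of `S` are pairwise compatible. -/
def IsClique {α : Type*} [Add α] [LT α] (b : Fin 4 → Fin 4 → α) (S : Finset Arc) : Prop :=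
  ∀ c ∈ S, ∀ d ∈ S, IsCompatible b c d

lemma IsClique.isForest {S : Finset Arc} (hS : IsClique b S) : IsForest S := by
  refine ⟨fun c hc d hd => (hS c hc d hd).1, fun c hc d hd h1 h2 e he e' he' hec hed => ?_⟩
  have h3 := (hS c hc d hd).2.2
  have h4 := (hS e he e' he').2.2
  simp only [hec, hed, h1, h2, h2.symm, false_or] at h3 h4
  exact lt_asymm h3 h4

lemma isClique_of_mem_activeSets (hb : StrictTriangle b) (hm : NonzeroMinors b) {S : Finset Arc}
    (hS : S ∈ activeSets arcForm (arcBound b)) : IsClique b S := by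
  intro c hc d hd
  have hcd := hb.noPath hS c hc d hd
  have hdc := hb.noPath hS d hd c hc
  refine ⟨hcd, hdc, ?_⟩
  by_contra! h
  obtain ⟨x, hx, rfl⟩ := hS
  refine hm _ _ _ _ c.2 h.1 hcd hdc.symm h.2.1 d.2 (le_antisymm ?_ h.2.2)
  exact (swap_active hx hc hd hcd hdc).1

lemma exists_activeSet_eq {S : Finset Arc} (w : Fin 4 → ℝ)
    (h : ∀ p q (hpq : p ≠ q), w q - w p ≤ b p q ∧
      (w q - w p = b p q ↔ (⟨(p, q), hpq⟩ : Arc) ∈ S)) :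
    S ∈ activeSets arcForm (arcBound b) := by
  obtain ⟨x, hx⟩ := exists_homCoord_eq w
  refine ⟨x, mem_alcoved_iff.2 fun i j hij => ?_, Finset.ext fun c => ?_⟩
  · rw [hx, hx, sub_sub_sub_cancel_right]
    exact (h i j hij).1
  · rw [mem_active_iff, hx, hx, sub_sub_sub_cancel_right]
    exact (h _ _ c.2).2

/-- The vertex that belongs to an out-star is a row of the matrix. -/
lemma outStar_mem_activeSets (hb : StrictTriangle b) (h0 : ∀ i, b i i = 0) (i : Fin 4) :
    Finset.univ.filter (fun c : Arc => c.1.1 = i) ∈ activeSets arcForm (arcBound b) := by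
  refine exists_activeSet_eq (b i) fun p q hpq => ?_
  rw [Finset.mem_filter_univ]
  dsimp only
  by_cases hp : p = i
  · subst hp; simp [h0]
  · have : b i q - b i p < b p q := by
      by_cases hq : q = i
      · subst hq
        linarith [h0 q, hb.pos hpq]
      · linarith [hb i q p (Ne.symm hq) (Ne.symm hp) hpq]
    exact ⟨this.le, by simp [hp, this.ne]⟩

/-- The vertex that belongs to an in-star is the negative of a column of the matrix. -/
lemma inStar_mem_activeSets (hb : StrictTriangle b) (h0 : ∀ i, b i i = 0) (j : Fin 4) :
    Finset.univ.filter (fun c : Arc => c.1.2 = j) ∈ activeSets arcForm (arcBound b) := by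
  refine exists_activeSet_eq (fun i => -b i j) fun p q hpq => ?_
  rw [Finset.mem_filter_univ]
  dsimp only
  by_cases hq : q = j
  · subst hq; simp [h0]
  · have : -b q j - -b p j < b p q := by
      by_cases hp : p = j
      · subst hp
        linarith [h0 p, hb.pos hpq]
      · linarith [hb p j q hp hpq hq]
    exact ⟨this.le, by simp only [hq, iff_false]; exact this.ne⟩

/-- A path with three edges belongs to a vertex as soon as its two end edges are compatible. -/
lemma path_mem_activeSets (hb : StrictTriangle b) {i j k m : Fin 4}
    (hij : i ≠ j) (hkm : k ≠ m) (hik : i ≠ k) (him : i ≠ m) (hjk : j ≠ k) (hjm : j ≠ m)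
    (hlt : b i j + b k m < b i m + b k j) :
    Finset.univ.filter (fun c : Arc => c.1 = (i, j) ∨ c.1 = (i, m) ∨ c.1 = (k, m)) ∈
      activeSets arcForm (arcBound b) := by
  refine exists_activeSet_eq (fun p => if p = j then b i j else if p = m then b i m
      else if p = k then b i m - b k m else 0) fun p q hpq => ?_
  rw [Finset.mem_filter_univ]
  dsimp only
  have h1 := hb i j m hij him hjm.symm
  have h2 := hb i m j him hij hjm
  have h3 := hb k m i hkm hik.symm him
  have h4 := hb i m k him hik hkm
  have h7 := hb j m k hjm hjk hkm
  have h8 := hb.pos hij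
  have h9 := hb.pos hkm
  have h10 := hb.pos him
  have hp := forall_eq_or hij hik him hjk hjm hkm p
  have hq := forall_eq_or hij hik him hjk hjm hkm q
  rcases hp with rfl | rfl | rfl | rfl <;> rcases hq with rfl | rfl | rfl | rfl <;>
    first
    | exact absurd rfl hpq
    | simp [*, Ne.symm]; done
    | simp [*, Ne.symm]; constructor <;> linarith

end Alcoved

section Generic

variable {b : Fin 4 → Fin 4 → ℝ}

/-- The combinatorial type of a generic alcoved polyhedron: its faces correspond to the cliques of
the compatibility relation. -/
lemma mem_activeSets_iff_isClique (hb : StrictTriangle b) (hm : NonzeroMinors b)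
    (h0 : ∀ i, b i i = 0) {S : Finset Arc} :
    S ∈ activeSets arcForm (arcBound b) ↔ IsClique b S := by
  refine ⟨isClique_of_mem_activeSets hb hm, fun hS => ?_⟩
  have key : ∀ T ∈ activeSets arcForm (arcBound b), S ⊆ T → S ∈ activeSets arcForm (arcBound b) :=
    fun T hT h => (isClique_of_mem_activeSets hb hm hT).isForest.isFreeSystem.mem_activeSets hT h
  rcases hS.isForest.cases with ⟨i, hi⟩ | ⟨j, hj⟩ |
    ⟨i, j, k, m, hij, hkm, hik, him, hjk, hjm, hc, hd, hall⟩
  · exact key _ (outStar_mem_activeSets hb h0 i) fun c hc => by simpa using hi c hc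
  · exact key _ (inStar_mem_activeSets hb h0 j) fun c hc => by simpa using hj c hc
  · refine key _ (path_mem_activeSets hb hij hkm hik him hjk hjm ?_) fun c hc => by
      simpa using hall c hc
    have := (hS _ hc _ hd).2.2
    simpa [hik, hjm] using this

lemma IsClique.finrank_commonKer {S : Finset Arc} (hS : IsClique b S) :
    Module.finrank ℝ (commonKer arcForm S) + S.card = 3 :=
  hS.isForest.isFreeSystem.finrank_commonKer

lemma isFaceOfDim_iff_of_generic (hb : StrictTriangle b) (hm : NonzeroMinors b)
    (h0 : ∀ i, b i i = 0) {S₀ : Finset Arc} {d : ℕ} {F : Set (Fin 3 → ℝ)} :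
    IsFaceOfDim (faceOf arcForm (arcBound b) S₀) d F ↔
      ∃ S, IsClique b S ∧ S₀ ⊆ S ∧ d + S.card = 3 ∧ faceOf arcForm (arcBound b) S = F := by
  rw [isFaceOfDim_faceOf_iff]
  simp only [mem_activeSets_iff_isClique hb hm h0]
  refine exists_congr fun S => and_congr_right fun hS => and_congr_right fun _ =>
    and_congr_left fun _ => ?_
  have := hS.finrank_commonKer
  lia

/-- Counting faces amounts to counting cliques. -/
lemma ncard_image_cliques (hb : StrictTriangle b) (hm : NonzeroMinors b) (h0 : ∀ i, b i i = 0)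
    (p : Finset Arc → Prop) (d : ℕ) :
    {F | ∃ S, IsClique b S ∧ p S ∧ d + S.card = 3 ∧ faceOf arcForm (arcBound b) S = F}.ncard =
      {S | IsClique b S ∧ p S ∧ d + S.card = 3}.ncard := by
  rw [← ncard_image_faceOf (f := arcForm) (β := arcBound b)
    fun S hS => (mem_activeSets_iff_isClique hb hm h0).2 hS.1]
  congr 1
  ext F
  simp [Set.mem_image, and_assoc]

/-! ### Polyhedra with the maximal `f`-vector are generic -/

lemma ncard_faces_eq_ncard_activeSets (d : ℕ) :
    {F | IsFaceOfDim (polyhedron arcForm (arcBound b)) d F}.ncard =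
      {S | S ∈ activeSets arcForm (arcBound b) ∧
        Module.finrank ℝ (commonKer arcForm S) = d}.ncard := by
  rw [← ncard_image_faceOf fun S hS => hS.1, ← faceOf_empty]
  congr 1
  ext F
  simp [isFaceOfDim_faceOf_iff, Set.mem_image, and_assoc]

lemma noPath_singleton (c : Arc) : NoPath {c} := by
  simpa [NoPath] using c.2

lemma strictTriangle_of_ncard_facets
    (h : {F | IsFaceOfDim (polyhedron arcForm (arcBound b)) 2 F}.ncard = 12) :
    StrictTriangle b := by
  intro i j k hij hik hkj
  rw [ncard_faces_eq_ncard_activeSets] at h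
  obtain ⟨x, hx, hact⟩ := singleton_mem_activeSets
    (fun c => ((noPath_singleton c).isForest (by simp)).isFreeSystem) (by norm_num)
    (h.trans (by decide)) (⟨(i, j), hij⟩ : Arc)
  have hmem : ∀ c : Arc, homCoord c.1.2 x - homCoord c.1.1 x = b c.1.1 c.1.2 ↔
      c = ⟨(i, j), hij⟩ := fun c => by rw [← mem_active_iff, hact, Finset.mem_singleton]
  have h1 := (hmem ⟨(i, j), hij⟩).2 rfl
  have h2 := mt (hmem ⟨(i, k), hik⟩).1 (by simpa using hkj)
  have h3 := mt (hmem ⟨(k, j), hkj⟩).1 (by simpa using hik.symm)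
  have h4 := lt_of_le_of_ne (mem_alcoved_iff.1 hx i k hik) h2
  have h5 := lt_of_le_of_ne (mem_alcoved_iff.1 hx k j hkj) h3
  dsimp only at h1
  linarith

/-- The arcs obtained from the arcs of `S` by exchanging the heads of two of them. -/
def swapHeads (S : Finset Arc) : Finset Arc :=
  Finset.univ.filter fun e => ∃ c ∈ S, ∃ d ∈ S, c ≠ d ∧ e.1 = (c.1.1, d.1.2)

/-- The pairs of arcs that do not form a path of length two. -/
def noPathPairs : Finset (Finset Arc) := (Finset.univ.powersetCard 2).filter NoPath

lemma card_noPathPairs : noPathPairs.card = 36 := by decide +kernel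

lemma card_fixed_noPathPairs : (noPathPairs.filter fun S => swapHeads S = S).card = 24 := by
  decide +kernel

lemma swapHeads_pair {c d : Arc} (hcd : c ≠ d) (h1 : c.1.1 ≠ d.1.2) (h2 : d.1.1 ≠ c.1.2) :
    swapHeads {c, d} = {⟨(c.1.1, d.1.2), h1⟩, ⟨(d.1.1, c.1.2), h2⟩} := by
  ext e
  have hne := Subtype.coe_injective.ne hcd
  simp [swapHeads, Subtype.ext_iff, hne, hne.symm, c.2, d.2]

lemma swapHeads_swapHeads {S : Finset Arc} (hS : S ∈ noPathPairs) : swapHeads S ∈ noPathPairs ∧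
    swapHeads (swapHeads S) = S := by
  obtain ⟨hS, hpath⟩ := Finset.mem_filter.1 hS
  obtain ⟨c, d, hcd, rfl⟩ := Finset.card_eq_two.1 (Finset.mem_powersetCard.1 hS).2
  have h1 := hpath c (by simp) d (by simp)
  have h2 := hpath d (by simp) c (by simp)
  have hne : (⟨(c.1.1, d.1.2), h1⟩ : Arc) ≠ ⟨(d.1.1, c.1.2), h2⟩ := by
    intro h
    simp only [Subtype.mk.injEq, Prod.mk.injEq] at h
    exact hcd (Subtype.ext (Prod.ext h.1 h.2.symm))
  rw [swapHeads_pair hcd h1 h2]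
  refine ⟨Finset.mem_filter.2 ⟨Finset.mem_powersetCard.2 ⟨Finset.subset_univ _,
    Finset.card_pair hne⟩, ?_⟩, swapHeads_pair hne c.2 d.2⟩
  have := c.2
  have := d.2
  simp [NoPath, *]

/-- With strict triangle inequalities, the active set of an edge consists of two arcs. -/
lemma StrictTriangle.mem_noPathPairs (hb : StrictTriangle b) {S : Finset Arc}
    (hS : S ∈ activeSets arcForm (arcBound b))
    (hd : Module.finrank ℝ (commonKer arcForm S) = 1) : S ∈ noPathPairs := by
  have hpath := hb.noPath hS
  have hcard : S.card ≤ 3 := by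
    by_contra! h
    obtain ⟨T, hTS, hT⟩ := Finset.exists_subset_card_eq h.le
    have h1 := ((hpath.mono hTS).isForest hT.le).isFreeSystem.finrank_commonKer
    have h2 := Submodule.finrank_mono (commonKer_anti (f := arcForm) hTS)
    lia
  have := (hpath.isForest hcard).isFreeSystem.finrank_commonKer
  exact Finset.mem_filter.2 ⟨Finset.mem_powersetCard.2 ⟨Finset.subset_univ S, by lia⟩, hpath⟩

/-- If exchanging the heads of the two active arcs of an edge does not change the sum of the
entries, then it does not change the two arcs. -/
lemma swapHeads_eq_of_sum_eq (hb : StrictTriangle b) {c d : Arc} (hcd : c ≠ d)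
    (hS : {c, d} ∈ activeSets arcForm (arcBound b))
    (heq : b c.1.1 c.1.2 + b d.1.1 d.1.2 = b c.1.1 d.1.2 + b d.1.1 c.1.2) :
    swapHeads {c, d} = {c, d} := by
  have h1 := hb.noPath hS c (by simp) d (by simp)
  have h2 := hb.noPath hS d (by simp) c (by simp)
  obtain ⟨x, hx, hact⟩ := hS
  have hsw := (swap_active hx (by rw [hact]; simp) (by rw [hact]; simp) h1 h2).2 heq
  rw [hact] at hsw
  rw [swapHeads_pair hcd h1 h2]
  refine Finset.eq_of_subset_of_card_le (by simp [Finset.insert_subset_iff, hsw.1, hsw.2]) ?_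
  rw [Finset.card_pair hcd, Finset.card_pair]
  intro h
  simp only [Subtype.mk.injEq, Prod.mk.injEq] at h
  exact hcd (Subtype.ext (Prod.ext h.1 h.2.symm))

lemma swapHeads_eq_of_both_active (hb : StrictTriangle b) {S : Finset Arc} (hS2 : S.card = 2)
    (hS : S ∈ activeSets arcForm (arcBound b))
    (hS' : swapHeads S ∈ activeSets arcForm (arcBound b)) : swapHeads S = S := by
  obtain ⟨c, d, hcd, rfl⟩ := Finset.card_eq_two.1 hS2
  refine swapHeads_eq_of_sum_eq hb hcd hS (le_antisymm ?_ ?_)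
  all_goals
    have h1 := hb.noPath hS c (by simp) d (by simp)
    have h2 := hb.noPath hS d (by simp) c (by simp)
  · obtain ⟨x, hx, hact⟩ := hS
    exact (swap_active hx (by rw [hact]; simp) (by rw [hact]; simp) h1 h2).1
  · rw [swapHeads_pair hcd h1 h2] at hS'
    obtain ⟨x, hx, hact⟩ := hS'
    exact (swap_active (c := ⟨(c.1.1, d.1.2), h1⟩) (d := ⟨(d.1.1, c.1.2), h2⟩) hx
      (by rw [hact]; simp) (by rw [hact]; simp) c.2 d.2).1

/-- There are 36 pairs of arcs without a path. If the 30 edges realise 30 of them, then, since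
`swapHeads` fixes only 24 pairs and never exchanges two realised ones, for every pair either the
pair itself or its image under `swapHeads` is realised. -/
lemma nonzeroMinors_of_ncard_edges (hb : StrictTriangle b)
    (h : {F | IsFaceOfDim (polyhedron arcForm (arcBound b)) 1 F}.ncard = 30) :
    NonzeroMinors b := by
  classical
  rw [ncard_faces_eq_ncard_activeSets] at h
  set E : Finset (Finset Arc) := Finset.univ.filter fun S => S ∈ activeSets arcForm (arcBound b) ∧
    Module.finrank ℝ (commonKer arcForm S) = 1 with hE
  have hmemE : ∀ S, S ∈ E ↔ S ∈ activeSets arcForm (arcBound b) ∧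
    Module.finrank ℝ (commonKer arcForm S) = 1 := fun S => by simp [hE]
  have hcardE : E.card = 30 := by
    rw [← h, ← Set.ncard_coe_finset]
    congr 1
    ext S
    simp [hmemE]
  have hEQ : E ⊆ noPathPairs := fun S hS =>
    hb.mem_noPathPairs ((hmemE S).1 hS).1 ((hmemE S).1 hS).2
  have hcard2 : ∀ S ∈ noPathPairs, S.card = 2 := fun S hS =>
    (Finset.mem_powersetCard.1 (Finset.mem_filter.1 hS).1).2
  have hinj : Set.InjOn swapHeads (E : Set (Finset Arc)) := fun S hS T hT hST => by
    rw [← (swapHeads_swapHeads (hEQ hS)).2, hST, (swapHeads_swapHeads (hEQ hT)).2]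
  have hinter : E ∩ E.image swapHeads ⊆ noPathPairs.filter fun S => swapHeads S = S := by
    intro S hS
    obtain ⟨hSE, hS'⟩ := Finset.mem_inter.1 hS
    obtain ⟨T, hT, rfl⟩ := Finset.mem_image.1 hS'
    have hTQ := swapHeads_swapHeads (hEQ hT)
    refine Finset.mem_filter.2 ⟨hEQ hSE, swapHeads_eq_of_both_active hb (hcard2 _ (hEQ hSE))
      ((hmemE _).1 hSE).1 ?_⟩
    rw [hTQ.2]
    exact ((hmemE _).1 hT).1
  have hunion : E ∪ E.image swapHeads = noPathPairs := by
    refine Finset.eq_of_subset_of_card_le (Finset.union_subset hEQ ?_) ?_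
    · intro S hS
      obtain ⟨T, hT, rfl⟩ := Finset.mem_image.1 hS
      exact (swapHeads_swapHeads (hEQ hT)).1
    · have h1 := Finset.card_union_add_card_inter E (E.image swapHeads)
      have h2 := Finset.card_le_card hinter
      rw [card_fixed_noPathPairs] at h2
      rw [Finset.card_image_of_injOn hinj, hcardE] at h1
      rw [card_noPathPairs]
      lia
  intro i j k m hij hik him hjk hjm hkm heq
  have hne : (⟨(i, j), hij⟩ : Arc) ≠ ⟨(k, m), hkm⟩ := by simp [hik]
  have hne' : (⟨(i, m), him⟩ : Arc) ≠ ⟨(k, j), hjk.symm⟩ := by simp [hik]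
  have hmem : {⟨(i, j), hij⟩, ⟨(k, m), hkm⟩} ∈ noPathPairs := by
    refine Finset.mem_filter.2 ⟨Finset.mem_powersetCard.2 ⟨Finset.subset_univ _,
      Finset.card_pair hne⟩, ?_⟩
    simp [NoPath, hij, hkm, him, hjk.symm]
  have hswap : swapHeads {⟨(i, j), hij⟩, ⟨(k, m), hkm⟩} = {⟨(i, m), him⟩, ⟨(k, j), hjk.symm⟩} :=
    swapHeads_pair hne him hjk.symm
  have hfix : swapHeads {⟨(i, j), hij⟩, ⟨(k, m), hkm⟩} ≠ {⟨(i, j), hij⟩, ⟨(k, m), hkm⟩} := by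
    rw [hswap]
    intro hcontra
    have : (⟨(i, m), him⟩ : Arc) ∈ ({⟨(i, j), hij⟩, ⟨(k, m), hkm⟩} : Finset Arc) := by
      rw [← hcontra]; simp
    simp [hjm.symm, hik] at this
  have hinv := (swapHeads_swapHeads hmem).2
  rw [← hunion, Finset.mem_union, Finset.mem_image] at hmem
  rcases hmem with hmem | ⟨T, hT, hTeq⟩
  · exact hfix (swapHeads_eq_of_sum_eq hb hne ((hmemE _).1 hmem).1 heq)
  · have hTeq' : T = {⟨(i, m), him⟩, ⟨(k, j), hjk.symm⟩} := by
      rw [← hswap, ← hTeq, (swapHeads_swapHeads (hEQ hT)).2]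
    subst hTeq'
    have := swapHeads_eq_of_sum_eq hb hne' ((hmemE _).1 hT).1 heq.symm
    rw [hTeq, ← hswap] at this
    exact hfix this.symm

end Generic

/-! ### The North Cask of a generic alcoved polyhedron -/

/-- A matrix `b` of bounds is generic if its triangle inequalities are strict and its 2-minors are
nonzero; it is normalised by zeros on the diagonal and in the last row. -/
structure IsGeneric (b : Fin 4 → Fin 4 → ℝ) : Prop where
  strictTriangle : StrictTriangle b
  nonzeroMinors : NonzeroMinors b
  diag : ∀ i, b i i = 0
  last : ∀ j, b 3 j = 0

/-- The arc of the inequality `x_i ≤ 0`, which is tight at the North Pole. -/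
def northArc (i : Fin 3) : Arc := ⟨(3, i.castSucc), (Fin.castSucc_lt_last i).ne'⟩

lemma castSucc_shift_ne (i : Fin 3) : i.castSucc ≠ (i + 1).castSucc ∧
    i.castSucc ≠ (i + 2).castSucc ∧ (i + 1).castSucc ≠ (i + 2).castSucc ∧
    i.castSucc ≠ 3 ∧ (i + 1).castSucc ≠ 3 ∧ (i + 2).castSucc ≠ 3 := by
  revert i; decide

lemma northArc_injective : Function.Injective northArc := by decide

section Cask

variable {b : Fin 4 → Fin 4 → ℝ}

lemma IsGeneric.pos (hg : IsGeneric b) {i j : Fin 4} (hij : i ≠ j) (hi : i ≠ 3) : 0 < b i j := by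
  by_cases hj : j = 3
  · subst hj
    linarith [hg.strictTriangle.pos hij, hg.last i]
  · linarith [hg.strictTriangle 3 j i (Ne.symm hj) hi.symm hij, hg.last i, hg.last j]

lemma IsGeneric.nonneg (hg : IsGeneric b) (i j : Fin 4) : 0 ≤ b i j := by
  by_cases hij : i = j
  · rw [hij, hg.diag]
  · by_cases hi : i = 3
    · rw [hi, hg.last]
    · exact (hg.pos hij hi).le

lemma IsGeneric.isNorthPole_iff (hg : IsGeneric b) {N : Fin 3 → ℝ} :
    IsNorthPole (polyhedron arcForm (arcBound b)) N ↔ N = 0 := by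
  have h0 : IsGreatest (polyhedron arcForm (arcBound b)) 0 := by
    refine ⟨mem_alcoved_iff.2 fun i j _ => by simpa using hg.nonneg i j, fun x hx i => ?_⟩
    have := mem_alcoved_iff.1 hx 3 i.castSucc (Fin.castSucc_lt_last i).ne'
    simpa [hg.last] using this
  exact ⟨fun h => h.unique h0, fun h => h ▸ h0⟩

lemma isClique_singleton (c : Arc) : IsClique b {c} := by
  have := c.2
  simp [IsClique, IsCompatible, this]

lemma IsGeneric.mem_northCaskFacets_iff (hg : IsGeneric b) {F : Set (Fin 3 → ℝ)} :
    F ∈ northCaskFacets (polyhedron arcForm (arcBound b)) ↔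
      ∃ i, F = faceOf arcForm (arcBound b) {northArc i} := by
  simp only [northCaskFacets, Set.mem_ofPred_eq, hg.isNorthPole_iff, exists_eq_left]
  rw [← faceOf_empty, isFaceOfDim_iff_of_generic hg.strictTriangle hg.nonzeroMinors hg.diag]
  constructor
  · rintro ⟨⟨S, -, -, hcard, rfl⟩, h0⟩
    obtain ⟨⟨⟨i, j⟩, hij⟩, rfl⟩ := Finset.card_eq_one.1 (show S.card = 1 by lia)
    have hz : arcBound b ⟨(i, j), hij⟩ = 0 := by simpa using (h0.2 _ (by simp)).symm
    obtain rfl : i = 3 := by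
      by_contra hi
      exact (hg.pos hij hi).ne' hz
    obtain ⟨j, rfl⟩ := Fin.exists_castSucc_eq.2 hij.symm
    exact ⟨j, rfl⟩
  · rintro ⟨i, rfl⟩
    refine ⟨⟨_, isClique_singleton (northArc i), by simp, by simp, rfl⟩, ?_, ?_⟩
    · exact (hg.isNorthPole_iff.2 rfl).1
    · simp [arcBound, northArc, hg.last]

lemma IsGeneric.northCaskFaces_eq (hg : IsGeneric b) (d : ℕ) :
    northCaskFaces (polyhedron arcForm (arcBound b)) d =
      {F | ∃ S, IsClique b S ∧ (∃ i, northArc i ∈ S) ∧ d + S.card = 3 ∧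
        faceOf arcForm (arcBound b) S = F} := by
  ext G
  simp only [northCaskFaces, Set.mem_ofPred_eq, hg.mem_northCaskFacets_iff]
  rw [← faceOf_empty, isFaceOfDim_iff_of_generic hg.strictTriangle hg.nonzeroMinors hg.diag]
  have hsub : ∀ S, IsClique b S → ∀ i, faceOf arcForm (arcBound b) S ⊆
      faceOf arcForm (arcBound b) {northArc i} ↔ northArc i ∈ S := fun S hS i => by
    rw [faceOf_subset_faceOf_iff ((mem_activeSets_iff_isClique hg.strictTriangle hg.nonzeroMinors
      hg.diag).2 hS), Finset.singleton_subset_iff]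
  constructor
  · rintro ⟨⟨S, hS, -, hd, rfl⟩, _, ⟨i, rfl⟩, h⟩
    exact ⟨S, hS, ⟨i, (hsub S hS i).1 h⟩, hd, rfl⟩
  · rintro ⟨S, hS, ⟨i, hi⟩, hd, rfl⟩
    exact ⟨⟨S, hS, by simp, hd, rfl⟩, _, ⟨i, rfl⟩, (hsub S hS i).2 hi⟩

/-! ### Integral models of the eight northern sign patterns -/

/-- A generic integral matrix for each pattern of northern signs: the pattern `s` holds `true` at
`i` when the entry at `(i, i + 1)` is smaller than the entry at `(i, i - 1)`. The entry `9` or `11`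
decides the sign of the northern minor; it is the only departure from the values `10` and `15`, for
which the triangle inequalities hold with room to spare, and it makes the other 2-minors nonzero as
well. -/
def modelMatrix (s : Fin 3 → Bool) (i j : Fin 4) : ℕ :=
  if i = j ∨ i = 3 then 0 else if j = 3 then 15 else
    if (i.val + 1) % 3 = j.val then 10 else if s (Fin.ofNat 3 i.val) then 11 else 9

instance (s : Fin 3 → Bool) (c d : Arc) : Decidable (IsCompatible (modelMatrix s) c d) :=
  inferInstanceAs (Decidable (_ ∧ _))

instance (s : Fin 3 → Bool) (S : Finset Arc) : Decidable (IsClique (modelMatrix s) S) :=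
  inferInstanceAs (Decidable (∀ c ∈ S, ∀ d ∈ S, _))

/-- The pattern of the signs of the three northern 2-minors of `b`. -/
noncomputable def northPattern (b : Fin 4 → Fin 4 → ℝ) (i : Fin 3) : Bool :=
  open Classical in decide (b i.castSucc (i + 1).castSucc < b i.castSucc (i - 1).castSucc)

lemma northPattern_iff {i : Fin 3} : northPattern b i = true ↔
    b i.castSucc (i + 1).castSucc < b i.castSucc (i - 1).castSucc := by
  simp [northPattern]

lemma IsGeneric.northPattern_not_iff (hg : IsGeneric b) {i : Fin 3} : northPattern b i = false ↔
    b i.castSucc (i - 1).castSucc < b i.castSucc (i + 1).castSucc := by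
  have hne : b i.castSucc (i + 1).castSucc ≠ b i.castSucc (i - 1).castSucc := fun h => by
    refine hg.nonzeroMinors i.castSucc (i + 1).castSucc 3 (i - 1).castSucc
      ?_ ?_ ?_ ?_ ?_ ?_ (by rw [hg.last, hg.last, h])
    all_goals clear * -; revert i; decide
  rw [← Bool.not_eq_true, northPattern_iff, not_lt]
  exact ⟨fun h => lt_of_le_of_ne h hne.symm, le_of_lt⟩

lemma IsGeneric.north_lt_iff (hg : IsGeneric b) {i j k : Fin 4} (hi : i ≠ 3) (hj : j ≠ 3)
    (hk : k ≠ 3) (hij : i ≠ j) (hik : i ≠ k) (hjk : j ≠ k) :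
    b i k < b i j ↔
      modelMatrix (northPattern b) i k < modelMatrix (northPattern b) i j := by
  obtain ⟨i, rfl⟩ := Fin.exists_castSucc_eq.2 hi
  obtain ⟨j, rfl⟩ := Fin.exists_castSucc_eq.2 hj
  obtain ⟨k, rfl⟩ := Fin.exists_castSucc_eq.2 hk
  have hcases : (k = i + 1 ∧ j = i - 1) ∨ (j = i + 1 ∧ k = i - 1) := by
    clear * - hij hik hjk
    revert i j k; decide
  have hmodel : ∀ (s : Fin 3 → Bool) (i : Fin 3),
      (modelMatrix s i.castSucc (i + 1).castSucc < modelMatrix s i.castSucc (i - 1).castSucc ↔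
        s i = true) ∧
      (modelMatrix s i.castSucc (i - 1).castSucc < modelMatrix s i.castSucc (i + 1).castSucc ↔
        s i = false) := by decide
  rcases hcases with ⟨rfl, rfl⟩ | ⟨rfl, rfl⟩
  · rw [(hmodel _ _).1, northPattern_iff]
  · rw [(hmodel _ _).2, hg.northPattern_not_iff]

lemma IsGeneric.isCompatible_iff (hg : IsGeneric b) {c d : Arc} (hc : c.1.2 ≠ 3)
    (hd : d.1.2 ≠ 3) :
    IsCompatible b c d ↔ IsCompatible (modelMatrix (northPattern b)) c d := by
  have h3 : ∀ s j, modelMatrix s 3 j = 0 := by decide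
  unfold IsCompatible
  refine and_congr_right fun h1 => and_congr_right fun h2 => ?_
  by_cases h4 : c.1.1 = d.1.1
  · simp [h4]
  by_cases h5 : c.1.2 = d.1.2
  · simp [h5]
  simp only [h4, h5, false_or]
  -- the four ends are distinct, so the vertex `3`, not being a head, is a tail
  obtain h | h : c.1.1 = 3 ∨ d.1.1 = 3 := by
    rcases forall_eq_or c.2 h4 h1 (Ne.symm h2) h5 d.2 3 with h | h | h | h
    · exact .inl h.symm
    · exact absurd h.symm hc
    · exact .inr h.symm
    · exact absurd h.symm hd
  · rw [h, hg.last, hg.last, h3, h3, zero_add, zero_add, zero_add, zero_add]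
    exact hg.north_lt_iff (fun h' => h4 (h.trans h'.symm)) hc hd h2 d.2 h5
  · rw [h, hg.last, hg.last, h3, h3, add_zero, add_zero, add_zero, add_zero]
    exact hg.north_lt_iff (fun h' => h4 (h'.trans h.symm)) hd hc h1 c.2 (Ne.symm h5)

/-- The cliques that contain a northern arc depend only on the northern signs. -/
lemma IsGeneric.isClique_iff (hg : IsGeneric b) {S : Finset Arc} {i : Fin 3}
    (hi : northArc i ∈ S) : IsClique b S ↔ IsClique (modelMatrix (northPattern b)) S := by
  constructor <;> intro h c hc d hd
  all_goals
    have hc3 : c.1.2 ≠ 3 := fun h' => (h _ hi c hc).1 h'.symm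
    have hd3 : d.1.2 ≠ 3 := fun h' => (h _ hi d hd).1 h'.symm
  · exact (hg.isCompatible_iff hc3 hd3).1 (h c hc d hd)
  · exact (hg.isCompatible_iff hc3 hd3).2 (h c hc d hd)

lemma IsGeneric.ncard_northern_cliques (hg : IsGeneric b) {p : Finset Arc → Prop}
    [DecidablePred p] (hp : ∀ S, p S → ∃ i, northArc i ∈ S) (d k : ℕ) (hdk : d + k = 3) :
    {F | ∃ S, IsClique b S ∧ p S ∧ d + S.card = 3 ∧ faceOf arcForm (arcBound b) S = F}.ncard =
      ((Finset.univ.powersetCard k).filter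
        fun S => IsClique (modelMatrix (northPattern b)) S ∧ p S).card := by
  rw [ncard_image_cliques hg.strictTriangle hg.nonzeroMinors hg.diag, ← Set.ncard_coe_finset]
  congr 1
  ext S
  simp only [Set.mem_ofPred_eq, Finset.coe_filter, Finset.mem_powersetCard_univ]
  constructor
  · rintro ⟨h1, h2, h3⟩
    obtain ⟨i, hi⟩ := hp S h2
    exact ⟨by lia, (hg.isClique_iff hi).1 h1, h2⟩
  · rintro ⟨h1, h2, h3⟩
    obtain ⟨i, hi⟩ := hp S h3
    exact ⟨(hg.isClique_iff hi).2 h2, h3, by lia⟩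

lemma card_cask (s : Fin 3 → Bool) :
    (((Finset.univ.powersetCard 3).filter
      fun S => IsClique (modelMatrix s) S ∧ ∃ i, northArc i ∈ S).card = 10 ∧
    ((Finset.univ.powersetCard 2).filter
      fun S => IsClique (modelMatrix s) S ∧ ∃ i, northArc i ∈ S).card = 12) ∧
    ((Finset.univ.powersetCard 1).filter
      fun S => IsClique (modelMatrix s) S ∧ ∃ i, northArc i ∈ S).card = 3 := by
  revert s
  decide +kernel

lemma IsGeneric.northCaskFVector_eq (hg : IsGeneric b) :
    northCaskFVector (polyhedron arcForm (arcBound b)) = (10, 12, 3) := by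
  obtain ⟨⟨h0, h1⟩, h2⟩ := card_cask (northPattern b)
  rw [northCaskFVector, hg.northCaskFaces_eq, hg.northCaskFaces_eq, hg.northCaskFaces_eq,
    hg.ncard_northern_cliques (fun _ h => h) 0 3 rfl,
    hg.ncard_northern_cliques (fun _ h => h) 1 2 rfl,
    hg.ncard_northern_cliques (fun _ h => h) 2 1 rfl, h0, h1, h2]

/-! ### The polygons of the North Cask -/

/-- The number of edges of the facet in the plane `x_i = 0`: a rectangle with up to two corners
cut off. -/
def gonNumber (s : Fin 3 → Bool) (i : Fin 3) : ℕ :=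
  4 + (s (i + 1)).toNat + (!s (i + 2)).toNat

lemma card_northern_polygon (s : Fin 3 → Bool) (i : Fin 3) :
    ((Finset.univ.powersetCard 3).filter
      fun S => IsClique (modelMatrix s) S ∧ northArc i ∈ S).card = gonNumber s i := by
  revert s i
  decide +kernel

lemma IsGeneric.isGon_iff (hg : IsGeneric b) (i : Fin 3) (p : ℕ) :
    IsGon p (faceOf arcForm (arcBound b) {northArc i}) ↔ p = gonNumber (northPattern b) i := by
  have hdim : IsFaceOfDim (faceOf arcForm (arcBound b) ∅) 2
      (faceOf arcForm (arcBound b) {northArc i}) :=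
    (isFaceOfDim_iff_of_generic hg.strictTriangle hg.nonzeroMinors hg.diag).2
      ⟨_, isClique_singleton _, by simp, by simp, rfl⟩
  have hcard : {v | IsFaceOfDim (faceOf arcForm (arcBound b) {northArc i}) 0 v}.ncard =
      gonNumber (northPattern b) i := by
    simp only [isFaceOfDim_iff_of_generic hg.strictTriangle hg.nonzeroMinors hg.diag,
      Finset.singleton_subset_iff]
    rw [hg.ncard_northern_cliques (fun _ h => ⟨i, h⟩) 0 3 rfl, card_northern_polygon]
  rw [IsGon, hcard]
  exact ⟨fun h => h.2.symm, fun h => ⟨hdim.2.2, h.symm⟩⟩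

/-- The facet in the plane `x_i = 0` is the rectangle `[-b_ji, 0] × [-b_ki, 0]` with the corners
beyond `x_k - x_j ≤ b_jk` and `x_j - x_k ≤ b_kj` cut off, where `j = i + 1` and `k = i + 2`. -/
lemma IsGeneric.mem_northFacet_iff (hg : IsGeneric b) {i : Fin 3} {x : Fin 3 → ℝ} :
    x ∈ faceOf arcForm (arcBound b) {northArc i} ↔ x i = 0 ∧
      (-b (i + 1).castSucc i.castSucc ≤ x (i + 1) ∧ x (i + 1) ≤ 0) ∧
      (-b (i + 2).castSucc i.castSucc ≤ x (i + 2) ∧ x (i + 2) ≤ 0) ∧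
      x (i + 2) - x (i + 1) ≤ b (i + 1).castSucc (i + 2).castSucc ∧
      x (i + 1) - x (i + 2) ≤ b (i + 2).castSucc (i + 1).castSucc := by
  obtain ⟨hij, hik, hjk, hi, hj, hk⟩ := castSucc_shift_ne i
  have hzero : ∀ x : Fin 3 → ℝ, arcForm (northArc i) x = arcBound b (northArc i) ↔ x i = 0 :=
    fun x => by simp [arcForm_apply, northArc, arcBound, hg.last]
  simp only [faceOf, Set.mem_ofPred_eq, Finset.mem_singleton, forall_eq, hzero]
  rw [and_comm]
  refine and_congr_right fun hxi => ?_
  constructor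
  · intro h
    have h := mem_alcoved_iff.1 h
    have h1 := h _ _ hij.symm
    have h2 := h _ _ hj.symm
    have h3 := h _ _ hik.symm
    have h4 := h _ _ hk.symm
    have h5 := h _ _ hjk
    have h6 := h _ _ hjk.symm
    simp only [homCoord_castSucc, homCoord_last, hg.last, hxi] at h1 h2 h3 h4 h5 h6
    refine ⟨⟨?_, ?_⟩, ⟨?_, ?_⟩, h5, h6⟩ <;> linarith
  · rintro ⟨⟨h1, h2⟩, ⟨h3, h4⟩, h5, h6⟩
    have hT := hg.strictTriangle
    have t1 := hT (i + 1).castSucc i.castSucc 3 hij.symm hj hi.symm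
    have t2 := hT (i + 2).castSucc i.castSucc 3 hik.symm hk hi.symm
    rw [hg.last] at t1 t2
    refine mem_alcoved_iff.2 fun p q hpq => ?_
    have hn := hg.nonneg p q
    rcases forall_eq_or hij hik hi hjk hj hk p with rfl | rfl | rfl | rfl <;>
    rcases forall_eq_or hij hik hi hjk hj hk q with rfl | rfl | rfl | rfl <;>
    first
    | exact absurd rfl hpq
    | simp only [homCoord_castSucc, homCoord_last, hg.last, hxi] at hn ⊢; linarith

/-- A pentagon cannot be left and right at the same time: the left one contains the lower right
corner of its rectangle, the right one lacks that corner of its own, so it would have to reach below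
the left one, and yet the minimum of its rectangle belongs to both. -/
lemma IsPentagonAtMax.chirality_unique {c c' : Chirality} {V : ℝ × ℝ} {S : Set (ℝ × ℝ)}
    (h : IsPentagonAtMax c V S) (h' : IsPentagonAtMax c' V S) : c = c' := by
  have key : IsPentagonAtMax .left V S → ¬ IsPentagonAtMax .right V S := by
    rintro ⟨a, h, v, hh, hha, hv, hva, hS⟩ ⟨a', h', v', hh', hha', hv', hva', hS'⟩
    dsimp only at hS hS'
    have e1 : (V.1, a.2) ∈ S := by
      rw [hS]
      refine ⟨⟨⟨by dsimp; linarith, le_rfl⟩, le_rfl, by dsimp; linarith⟩, ?_⟩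
      have : 1 ≤ (V.1 - a.1) / h := (one_le_div hh).2 hha.le
      have : 0 ≤ (V.2 - a.2) / v := div_nonneg (by linarith) hv.le
      dsimp only
      linarith
    have e2 : a' ∈ S := by
      rw [hS']
      refine ⟨⟨le_rfl, by constructor <;> linarith⟩, ?_⟩
      have : 1 ≤ (V.1 - a'.1) / h' := (one_le_div hh').2 hha'.le
      rw [sub_self, zero_div]
      linarith
    rw [hS'] at e1
    rw [hS] at e2
    have h1 := e1.2
    have h2 := e2.1.1.2
    dsimp only at h1
    rw [sub_self, zero_div, zero_add, one_le_div hv'] at h1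
    have h3 := e1.1.1.2
    dsimp only at h3
    have : a'.2 < a.2 := by linarith
    linarith
  cases c <;> cases c'
  · rfl
  · exact absurd h' (key h)
  · exact absurd h (key h')
  · rfl

/-- The word of a pattern of northern signs: left if most of the minors are negative. -/
def patternWord (s : Fin 3 → Bool) : Chirality :=
  if (s 0 && s 1) || (s 1 && s 2) || (s 2 && s 0) then .left else .right

lemma patternWord_eq_left {s : Fin 3 → Bool} {i : Fin 3} (h1 : s (i + 1) = true)
    (h2 : s (i + 2) = true) : patternWord s = .left := by
  rw [patternWord, if_pos]
  revert s i; decide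

lemma patternWord_eq_right {s : Fin 3 → Bool} {i : Fin 3} (h1 : s (i + 1) = false)
    (h2 : s (i + 2) = false) : patternWord s = .right := by
  rw [patternWord, if_neg]
  revert s i; decide

lemma gonNumber_eq_five_iff {s : Fin 3 → Bool} {i : Fin 3} :
    gonNumber s i = 5 ↔ s (i + 1) = s (i + 2) := by
  revert s i; decide

lemma exists_gonNumber_eq_five (s : Fin 3 → Bool) : ∃ i, gonNumber s i = 5 := by
  revert s; decide

lemma IsGeneric.isPentagonAtMax (hg : IsGeneric b) {i : Fin 3}
    (hi : gonNumber (northPattern b) i = 5) :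
    IsPentagonAtMax (patternWord (northPattern b)) (planeCoords i 0)
      (planeCoords i '' faceOf arcForm (arcBound b) {northArc i}) := by
  obtain ⟨hij, hik, hjk, -, hj, hk⟩ := castSucc_shift_ne i
  have p1 := hg.pos hjk hj
  have p2 := hg.pos hjk.symm hk
  have t1 := hg.strictTriangle _ _ _ hij.symm hjk hik.symm
  have t2 := hg.strictTriangle _ _ _ hik.symm hjk.symm hij.symm
  have e1 : i + 1 + 1 = i + 2 := by lia
  have e2 : i + 1 - 1 = i := by lia
  have e3 : i + 2 + 1 = i := by lia
  have e4 : i + 2 - 1 = i + 1 := by lia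
  have himage : ∀ z : ℝ × ℝ, z ∈ planeCoords i '' faceOf arcForm (arcBound b) {northArc i} ↔
      (-b (i + 1).castSucc i.castSucc ≤ z.1 ∧ z.1 ≤ 0) ∧
      (-b (i + 2).castSucc i.castSucc ≤ z.2 ∧ z.2 ≤ 0) ∧
      z.2 - z.1 ≤ b (i + 1).castSucc (i + 2).castSucc ∧
      z.1 - z.2 ≤ b (i + 2).castSucc (i + 1).castSucc := by
    intro z
    constructor
    · rintro ⟨x, hx, rfl⟩
      exact (hg.mem_northFacet_iff.1 hx).2
    · intro hz
      have n1 : i + 1 ≠ i := by lia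
      have n2 : i + 2 ≠ i := by lia
      have n3 : i + 2 ≠ i + 1 := by lia
      refine ⟨fun p => if p = i then 0 else if p = i + 1 then z.1 else z.2,
        hg.mem_northFacet_iff.2 ⟨by simp, ?_⟩, by simp [planeCoords]⟩
      simpa [n1, n2, n3] using hz
  rw [gonNumber_eq_five_iff] at hi
  set a : ℝ × ℝ := (-b (i + 1).castSucc i.castSucc, -b (i + 2).castSucc i.castSucc) with ha
  cases h1 : northPattern b (i + 1)
  · have h2 := hi.symm.trans h1
    rw [patternWord_eq_right h1 h2]
    rw [hg.northPattern_not_iff, e1, e2] at h1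
    rw [hg.northPattern_not_iff, e3, e4] at h2
    -- both legs of the triangle cut off have the length by which `b_kj` falls short of `b_ki`
    set l := b (i + 2).castSucc i.castSucc - b (i + 2).castSucc (i + 1).castSucc with hl
    have hlpos : 0 < l := by linarith
    refine ⟨a, l, l, hlpos, ?_, hlpos, ?_, Set.ext fun z => ?_⟩
    · simp [planeCoords, ha]; linarith
    · simp [planeCoords, ha]; linarith
    · rw [himage]
      simp only [planeCoords, ha, Set.mem_ofPred_eq, Set.mem_Icc, Prod.le_def, Pi.zero_apply,
        ← add_div, one_le_div hlpos]
      constructor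
      · rintro ⟨⟨h3, h4⟩, ⟨h5, h6⟩, h7, h8⟩
        exact ⟨⟨⟨h3, h5⟩, h4, h6⟩, by linarith⟩
      · rintro ⟨⟨⟨h3, h5⟩, h4, h6⟩, h7⟩
        exact ⟨⟨h3, h4⟩, ⟨h5, h6⟩, by linarith, by linarith⟩
  · have h2 := hi.symm.trans h1
    rw [patternWord_eq_left h1 h2]
    rw [northPattern_iff, e1, e2] at h1
    rw [northPattern_iff, e3, e4] at h2
    -- both legs of the triangle cut off have the length by which `b_jk` falls short of `b_ji`
    set l := b (i + 1).castSucc i.castSucc - b (i + 1).castSucc (i + 2).castSucc with hl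
    have hlpos : 0 < l := by linarith
    refine ⟨a, l, l, hlpos, ?_, hlpos, ?_, Set.ext fun z => ?_⟩
    · simp [planeCoords, ha]; linarith
    · simp [planeCoords, ha]; linarith
    · rw [himage]
      simp only [planeCoords, ha, Set.mem_ofPred_eq, Set.mem_Icc, Prod.le_def, Pi.zero_apply,
        ← add_div, one_le_div hlpos]
      constructor
      · rintro ⟨⟨h3, h4⟩, ⟨h5, h6⟩, h7, h8⟩
        exact ⟨⟨⟨h3, h5⟩, h4, h6⟩, by linarith⟩
      · rintro ⟨⟨⟨h3, h5⟩, h4, h6⟩, h7⟩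
        exact ⟨⟨h3, h4⟩, ⟨h5, h6⟩, by linarith, by linarith⟩

/-- The type of the North Cask for a pattern of northern signs. -/
def patternType (s : Fin 3 → Bool) : CaskType := ⟨gonNumber s, patternWord s⟩

lemma IsGeneric.hasNorthCaskType_iff (hg : IsGeneric b) (t : CaskType) :
    HasNorthCaskType (polyhedron arcForm (arcBound b)) t ↔ t = patternType (northPattern b) := by
  simp only [HasNorthCaskType, hg.isNorthPole_iff, exists_eq_left, hg.mem_northCaskFacets_iff]
  have hval : ∀ i, ∀ x ∈ faceOf arcForm (arcBound b) {northArc i}, x i = (0 : Fin 3 → ℝ) i :=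
    fun i x hx => (hg.mem_northFacet_iff.1 hx).1
  constructor
  · rintro ⟨-, h⟩
    have h' : ∀ i, IsGon (t.vector i) (faceOf arcForm (arcBound b) {northArc i}) ∧
        (t.vector i = 5 → IsPentagonAtMax t.word (planeCoords i 0)
          (planeCoords i '' faceOf arcForm (arcBound b) {northArc i})) := by
      intro i
      obtain ⟨_, ⟨j, rfl⟩, hplane, hgon⟩ := h i
      -- the facet in the plane `x_j = 0` lies in no other coordinate plane
      obtain rfl : j = i := by
        have hsub : faceOf arcForm (arcBound b) {northArc j} ⊆
            faceOf arcForm (arcBound b) {northArc i} := fun x hx => ⟨hx.1, fun c hc => by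
          rw [Finset.mem_singleton.1 hc]
          simpa [arcForm_apply, northArc, arcBound, hg.last] using hplane x hx⟩
        rw [faceOf_subset_faceOf_iff ((mem_activeSets_iff_isClique hg.strictTriangle
          hg.nonzeroMinors hg.diag).2 (isClique_singleton _)), Finset.singleton_subset_iff,
          Finset.mem_singleton] at hsub
        exact (northArc_injective hsub).symm
      exact hgon
    have hvec : t.vector = gonNumber (northPattern b) :=
      funext fun i => (hg.isGon_iff i _).1 (h' i).1
    obtain ⟨i, hi⟩ := exists_gonNumber_eq_five (northPattern b)
    have hword : t.word = patternWord (northPattern b) :=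
      ((h' i).2 (by rw [hvec, hi])).chirality_unique (hg.isPentagonAtMax hi)
    cases t
    simp only at hvec hword
    rw [patternType, hvec, hword]
  · rintro rfl
    exact ⟨exists_gonNumber_eq_five _, fun i => ⟨_, ⟨i, rfl⟩, hval i, (hg.isGon_iff i _).2 rfl,
      fun hi => hg.isPentagonAtMax hi⟩⟩

end Cask

/-! ### Visualized idempotent matrices -/

/-- The tropical span of the columns of a visualized idempotent matrix is the alcoved polyhedron
whose bounds are the negated entries. -/
lemma alcovedPolytope_eq {A : Matrix (Fin 4) (Fin 4) ℝ} (hA : IsVisualizedIdempotent A) :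
    alcovedPolytope A = polyhedron arcForm (arcBound fun i j => -A i j) := by
  obtain ⟨⟨-, hdiag⟩, htri, -⟩ := hA
  ext x
  have hsnoc : ∀ i, (Fin.snoc (α := fun _ => ℝ) x 0 : Fin 4 → ℝ) i = homCoord i x := fun i => by
    induction i using Fin.lastCases with
    | last => exact (Fin.snoc_last (α := fun _ => ℝ) 0 x).trans (homCoord_last x).symm
    | cast i => simp
  rw [mem_alcoved_iff]
  simp only [alcovedPolytope, tropicalSpan, Set.mem_ofPred_eq, hsnoc]
  constructor
  · rintro ⟨c, hc⟩ i j -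
    obtain ⟨k, -, hk⟩ := Finset.exists_mem_eq_sup' Finset.univ_nonempty fun k => c k + A j k
    have h1 := Finset.le_sup' (fun k => c k + A i k) (Finset.mem_univ k)
    rw [← hc] at h1 hk
    linarith [htri i k j]
  · intro h
    refine ⟨fun k => homCoord k x, fun i => le_antisymm ?_ ?_⟩
    · have := Finset.le_sup' (fun k => homCoord k x + A i k) (Finset.mem_univ i)
      simpa only [hdiag, add_zero] using this
    · refine Finset.sup'_le _ _ fun k _ => ?_
      by_cases hik : i = k
      · simp [hik, hdiag]
      · linarith [h i k hik]

lemma isGeneric_of_isMaximalDodecahedron {A : Matrix (Fin 4) (Fin 4) ℝ}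
    (hA : IsVisualizedIdempotent A) (hmax : IsMaximalDodecahedron (alcovedPolytope A)) :
    IsGeneric fun i j => -A i j := by
  rw [alcovedPolytope_eq hA, IsMaximalDodecahedron, fVector, Prod.mk.injEq, Prod.mk.injEq] at hmax
  have hT := strictTriangle_of_ncard_facets hmax.2.2
  exact ⟨hT, nonzeroMinors_of_ncard_edges hT hmax.2.1, fun i => by simp [hA.1.2],
    fun j => neg_eq_zero.2 (hA.2.2 j)⟩

lemma northPattern_eq {A : Matrix (Fin 4) (Fin 4) ℝ} (hA : IsVisualizedIdempotent A) :
    northPattern (fun i j => -A i j) = fun i => decide (northSigns A i = -1) := by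
  funext i
  rw [Bool.eq_iff_iff, northPattern_iff, decide_eq_true_iff, northSigns, sign_eq_neg_one_iff,
    twoMinor, hA.2.2, hA.2.2]
  constructor <;> intro h <;> linarith

lemma hasNorthCaskType_iff {A : Matrix (Fin 4) (Fin 4) ℝ} (hA : IsVisualizedIdempotent A)
    (hmax : IsMaximalDodecahedron (alcovedPolytope A)) (t : CaskType) :
    HasNorthCaskType (alcovedPolytope A) t ↔
      t = patternType fun i => decide (northSigns A i = -1) := by
  rw [← northPattern_eq hA, ← (isGeneric_of_isMaximalDodecahedron hA hmax).hasNorthCaskType_iff,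
    ← alcovedPolytope_eq hA]

/-! ### All types occur -/

lemma modelMatrix_triangle (s : Fin 3 → Bool) (i j k : Fin 4) :
    modelMatrix s i j ≤ modelMatrix s i k + modelMatrix s k j ∧ (i ≠ j → i ≠ k → k ≠ j →
      modelMatrix s i j < modelMatrix s i k + modelMatrix s k j) := by
  revert s i j k
  decide +kernel

lemma modelMatrix_minors (s : Fin 3 → Bool) (i j k m : Fin 4) (hij : i ≠ j) (hik : i ≠ k)
    (him : i ≠ m) (hjk : j ≠ k) (hjm : j ≠ m) (hkm : k ≠ m) :
    modelMatrix s i j + modelMatrix s k m ≠ modelMatrix s i m + modelMatrix s k j := by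
  revert s i j k m
  decide +kernel

lemma isGeneric_modelMatrix (s : Fin 3 → Bool) : IsGeneric fun i j => (modelMatrix s i j : ℝ) where
  strictTriangle i j k hij hik hkj := by
    dsimp only
    exact_mod_cast (modelMatrix_triangle s i j k).2 hij hik hkj
  nonzeroMinors i j k m hij hik him hjk hjm hkm := by
    dsimp only
    exact_mod_cast modelMatrix_minors s i j k m hij hik him hjk hjm hkm
  diag i := by simp [modelMatrix]
  last j := by simp [modelMatrix]

lemma northPattern_modelMatrix (s : Fin 3 → Bool) :
    northPattern (fun i j => (modelMatrix s i j : ℝ)) = s := by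
  have hmodel : ∀ (s : Fin 3 → Bool) (i : Fin 3),
      modelMatrix s i.castSucc (i + 1).castSucc < modelMatrix s i.castSucc (i - 1).castSucc ↔
        s i = true := by decide
  funext i
  rw [Bool.eq_iff_iff, northPattern_iff, Nat.cast_lt, hmodel]

lemma card_modelMatrix_cliques (s : Fin 3 → Bool) :
    (((Finset.univ.powersetCard 3).filter fun S => IsClique (modelMatrix s) S).card = 20 ∧
    ((Finset.univ.powersetCard 2).filter fun S => IsClique (modelMatrix s) S).card = 30) ∧
    ((Finset.univ.powersetCard 1).filter fun S => IsClique (modelMatrix s) S).card = 12 := by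
  revert s
  decide +kernel

lemma isClique_natCast_iff (s : Fin 3 → Bool) (S : Finset Arc) :
    IsClique (fun i j => (modelMatrix s i j : ℝ)) S ↔ IsClique (modelMatrix s) S := by
  simp only [IsClique, IsCompatible]
  norm_cast

lemma fVector_modelMatrix (s : Fin 3 → Bool) :
    fVector (polyhedron arcForm (arcBound fun i j => (modelMatrix s i j : ℝ))) = (20, 30, 12) := by
  have hg := isGeneric_modelMatrix s
  have key : ∀ d k : ℕ, d + k = 3 →
      {F | IsFaceOfDim (polyhedron arcForm (arcBound fun i j => (modelMatrix s i j : ℝ)))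
        d F}.ncard = ((Finset.univ.powersetCard k).filter
          fun S => IsClique (modelMatrix s) S).card := by
    intro d k hdk
    simp only [← faceOf_empty,
      isFaceOfDim_iff_of_generic hg.strictTriangle hg.nonzeroMinors hg.diag]
    rw [ncard_image_cliques hg.strictTriangle hg.nonzeroMinors hg.diag, ← Set.ncard_coe_finset]
    congr 1
    ext S
    simp only [Set.mem_ofPred_eq, Finset.coe_filter, Finset.mem_powersetCard_univ,
      Finset.empty_subset, true_and, isClique_natCast_iff]
    rw [and_comm]
    refine and_congr_left fun _ => ?_
    lia
  obtain ⟨⟨h0, h1⟩, h2⟩ := card_modelMatrix_cliques s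
  rw [fVector, key 0 3 rfl, key 1 2 rfl, key 2 1 rfl, h0, h1, h2]

/-- Every pattern of northern signs is realised by a maximal dodecahedron. -/
lemma exists_hasNorthCaskType (s : Fin 3 → Bool) : ∃ A : Matrix (Fin 4) (Fin 4) ℝ,
    IsVisualizedIdempotent A ∧ IsMaximalDodecahedron (alcovedPolytope A) ∧
      HasNorthCaskType (alcovedPolytope A) (patternType s) := by
  let A : Matrix (Fin 4) (Fin 4) ℝ := fun i j => -(modelMatrix s i j : ℝ)
  have hg := isGeneric_modelMatrix s
  have hA : IsVisualizedIdempotent A := by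
    refine ⟨⟨fun i j => neg_nonpos.2 (Nat.cast_nonneg _), fun i => ?_⟩,
      fun i j k => ?_, fun j => ?_⟩
    · exact neg_eq_zero.2 (hg.diag i)
    · have : (modelMatrix s i j : ℝ) ≤ modelMatrix s i k + modelMatrix s k j := by
        exact_mod_cast (modelMatrix_triangle s i j k).1
      simp only [A]
      linarith
    · exact neg_eq_zero.2 (hg.last j)
  have hneg : (fun i j => -A i j) = fun i j => (modelMatrix s i j : ℝ) := by
    simp only [A, neg_neg]
  refine ⟨A, hA, ?_, ?_⟩
  · rw [IsMaximalDodecahedron, alcovedPolytope_eq hA, hneg, fVector_modelMatrix]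
  · rw [alcovedPolytope_eq hA, hneg, hg.hasNorthCaskType_iff, northPattern_modelMatrix]

lemma patternType_injective : Function.Injective patternType := fun s t h =>
  have hword : ∀ u v : Bool, (if u then Chirality.left else .right) =
      (if v then Chirality.left else .right) → u = v := by
    intro u v; cases u <;> cases v <;> simp
  (show ∀ s t : Fin 3 → Bool, gonNumber s = gonNumber t →
    ((s 0 && s 1) || (s 1 && s 2) || (s 2 && s 0)) =
      ((t 0 && t 1) || (t 1 && t 2) || (t 2 && t 0)) →
    s = t by decide +kernel) s t (congrArg CaskType.vector h)
      (hword _ _ (congrArg CaskType.word h))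

lemma patternType_cases (s : Fin 3 → Bool) :
    (∃ τ : Equiv.Perm (Fin 3), (patternType s).vector = ![4, 5, 6] ∘ τ) ∨
      s = (fun _ => false) ∨ s = (fun _ => true) := by
  change (∃ τ : Equiv.Perm (Fin 3), gonNumber s = ![4, 5, 6] ∘ τ) ∨ _
  revert s
  decide +kernel

lemma exists_gonNumber_eq (τ : Equiv.Perm (Fin 3)) : ∃ s, gonNumber s = ![4, 5, 6] ∘ τ := by
  revert τ
  decide +kernel

lemma patternType_false : patternType (fun _ => false) = ⟨![5, 5, 5], Chirality.right⟩ := by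
  rw [patternType, show gonNumber (fun _ => false) = ![5, 5, 5] by decide]
  rfl

lemma patternType_true : patternType (fun _ => true) = ⟨![5, 5, 5], Chirality.left⟩ := by
  rw [patternType, show gonNumber (fun _ => true) = ![5, 5, 5] by decide]
  rfl

theorem mainTheorem2 :
    -- the type exists, is unique, and is determined by the three signs
    (∃ typ : (Fin 3 → SignType) → CaskType,
      ∀ A : Matrix (Fin 4) (Fin 4) ℝ, IsVisualizedIdempotent A →
        IsMaximalDodecahedron (alcovedPolytope A) →
        ∀ t : CaskType, HasNorthCaskType (alcovedPolytope A) t ↔ t = typ (northSigns A)) ∧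
    -- the possible types
    (∀ A : Matrix (Fin 4) (Fin 4) ℝ, IsVisualizedIdempotent A →
      IsMaximalDodecahedron (alcovedPolytope A) →
      ∀ t : CaskType, HasNorthCaskType (alcovedPolytope A) t →
        (∃ τ : Equiv.Perm (Fin 3), t.vector = ![4, 5, 6] ∘ τ) ∨
        t = ⟨![5, 5, 5], Chirality.right⟩ ∨ t = ⟨![5, 5, 5], Chirality.left⟩) ∧
    -- all of them occur
    (∀ τ : Equiv.Perm (Fin 3), ∃ A : Matrix (Fin 4) (Fin 4) ℝ, IsVisualizedIdempotent A ∧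
      IsMaximalDodecahedron (alcovedPolytope A) ∧
      ∃ c : Chirality, HasNorthCaskType (alcovedPolytope A) ⟨![4, 5, 6] ∘ τ, c⟩) ∧
    (∀ c : Chirality, ∃ A : Matrix (Fin 4) (Fin 4) ℝ, IsVisualizedIdempotent A ∧
      IsMaximalDodecahedron (alcovedPolytope A) ∧
      HasNorthCaskType (alcovedPolytope A) ⟨![5, 5, 5], c⟩) ∧
    -- there are eight types
    {t : CaskType | ∃ A : Matrix (Fin 4) (Fin 4) ℝ, IsVisualizedIdempotent A ∧
      IsMaximalDodecahedron (alcovedPolytope A) ∧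
      HasNorthCaskType (alcovedPolytope A) t}.ncard = 8 ∧
    -- the `f`-vector of the North Cask
    (∀ A : Matrix (Fin 4) (Fin 4) ℝ, IsVisualizedIdempotent A →
      IsMaximalDodecahedron (alcovedPolytope A) →
      northCaskFVector (alcovedPolytope A) = (10, 12, 3)) := by
  refine ⟨⟨fun σ => patternType fun i => decide (σ i = -1), fun A hA hmax t =>
    hasNorthCaskType_iff hA hmax t⟩, fun A hA hmax t ht => ?_, fun τ => ?_, fun c => ?_, ?_,
    fun A hA hmax => ?_⟩
  · rw [hasNorthCaskType_iff hA hmax] at ht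
    rw [ht]
    rcases patternType_cases fun i => decide (northSigns A i = -1) with h | h | h
    · exact .inl h
    · exact .inr (.inl (by rw [h, patternType_false]))
    · exact .inr (.inr (by rw [h, patternType_true]))
  · obtain ⟨s, hs⟩ := exists_gonNumber_eq τ
    obtain ⟨A, hA, hmax, h⟩ := exists_hasNorthCaskType s
    rw [patternType, hs] at h
    exact ⟨A, hA, hmax, _, h⟩
  · cases c
    · exact patternType_true ▸ exists_hasNorthCaskType fun _ => true
    · exact patternType_false ▸ exists_hasNorthCaskType fun _ => false
  · have hrange : {t : CaskType | ∃ A : Matrix (Fin 4) (Fin 4) ℝ, IsVisualizedIdempotent A ∧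
        IsMaximalDodecahedron (alcovedPolytope A) ∧
        HasNorthCaskType (alcovedPolytope A) t} = Set.range patternType := by
      ext t
      constructor
      · rintro ⟨A, hA, hmax, ht⟩
        exact ⟨_, ((hasNorthCaskType_iff hA hmax t).1 ht).symm⟩
      · rintro ⟨s, rfl⟩
        exact exists_hasNorthCaskType s
    rw [hrange, ← Set.image_univ, patternType_injective.injOn.ncard_image, Set.ncard_univ]
    simp
  · rw [alcovedPolytope_eq hA]
    exact (isGeneric_of_isMaximalDodecahedron hA hmax).northCaskFVector_eq
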